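/- Let $\rho_0,\lambda_0,\mu_0,\omega>0$ be the density, the Lamé moduli and the angular frequency of a homogeneous isotropic elastic background in $\mathbb{R}^2$. Put $c_P=\sqrt{(\lambda_0+2\mu_0)/\rho_0}$, $c_S=\sqrt{\mu_0/\rho_0}$ and $\kappa_\alpha=\omega/c_\alpha$ for $\alpha\in\{P,S\}$. For $m\in\mathbb{Z}$ and $\kappa>0$ let $v_m(x,\kappa)=H^{(1)}_m(\kappa|x|)e^{im\varphi_x}$, where $H^{(1)}_m$ is the Hankel function of the first kind and $\varphi_x$ is the polar angle of $x\in\mathbb{R}^2\setminus\{0\}$, and let $$\mathbf{H}^P_m=\nabla v_m(\cdot,\kappa_P),\qquad \mathbf{H}^S_m=\big(\partial_2 v_m(\cdot,\kappa_S),\,-\partial_1 v_m(\cdot,\kappa_S)\big)^\top .$$ For $R>0$ and $K,N_s,N_r\in\mathbb{N}$ put $\theta_s=2\pi s/N_s$ $(1\le s\le N_s)$, $\theta_r=2\pi r/N_r$, $d_r=(\cos\theta_r,\sin\theta_r)$, $d_r^\perp=(-\sin\theta_r,\cos\theta_r)$, $x_r=R\,d_r$ $(1\le r\le N_r)$. For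 $|m|,|n|\le K$ define $$(\mathbf{X}^\beta)_{sm}=\frac{e^{im(\pi/2-\theta_s)}}{(2\rho_0\omega c_\beta)^2\kappa_\beta},\qquad (\mathbf{Y}^\alpha_\parallel)_{rn}=\overline{\mathbf{H}^\alpha_n(x_r)}\cdot d_r,\qquad (\mathbf{Y}^\alpha_\perp)_{rn}=\overline{\mathbf{H}^\alpha_n(x_r)}\cdot d_r^\perp,$$ $$\mathbf{X}=\begin{pmatrix}\mathbf{X}^P&0\\0&\mathbf{X}^S\end{pmatrix},\qquad \mathbf{Y}=\begin{pmatrix}\mathbf{Y}^P_\parallel&\mathbf{Y}^S_\parallel\\ \mathbf{Y}^P_\perp&\mathbf{Y}^S_\perp\end{pmatrix},$$ and let $\mathbf{L}:\mathbb{C}^{(4K+2)\times(4K+2)}\to\mathbb{C}^{2N_s\times 2N_r}$, $\mathbf{L}(\mathbf{M})=\mathbf{X}\mathbf{M}\mathbf{Y}^*$. Let $\sigma_{\max}$ and $\sigma_{\min}$ be the largest and the smallest singular value of $\mathbf{L}$ with respect to the Frobenius inner products, and $\mathrm{cond}(\mathbf{L})=\sigma_{\max}/\sigma_{\min}$. Let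 $C_R^P=2/(e\kappa_P R)$. Then there is a constant $C>0$, independent of $R$, $K$, $N_s$, $N_r$, such that for every $R>0$ there is $K_0$ such that for all $K\ge K_0$ and all $N_s,N_r\ge 2K+1$ one has $\sigma_{\min}>0$ and $$\mathrm{cond}(\mathbf{L})\le C\,\big(C_R^P K\big)^{K+1}.$$ -/

import Mathlib

namespace ElasticMSR

open scoped Matrix Nat

noncomputable section

/-! ### Cylindrical Bessel, Neumann and Hankel functions of integer order -/

/-- The Bessel function of the first kind `J_n(t)` of order `n ≥ 0`, by its power series. -/
def besselJNat (n : ℕ) (t : ℝ) : ℝ :=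
  ∑' k : ℕ, (-1 : ℝ) ^ k / ((k ! : ℝ) * ((n + k)! : ℝ)) * (t / 2) ^ (n + 2 * k)

/-- The Bessel function of the second kind `Y_n(t)` of order `n ≥ 0` at `t > 0`, by its series
`Y_n(t) = -(1/π) ∑_{k<n} (n-k-1)!/k! (t/2)^(2k-n) + (2/π) log(t/2) J_n(t)
 - (1/π) ∑_k (ψ(k+1) + ψ(n+k+1)) (-1)^k/(k! (n+k)!) (t/2)^(n+2k)`;
the digamma values at positive integers are `ψ(j+1) = 1 + 1/2 + ⋯ + 1/j - γ`. -/
def besselYNat (n : ℕ) (t : ℝ) : ℝ :=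
  -(1 / Real.pi) * (∑ k ∈ Finset.range n,
      ((n - k - 1)! : ℝ) / (k ! : ℝ) * (t / 2) ^ (2 * (k : ℤ) - (n : ℤ)))
    + 2 / Real.pi * Real.log (t / 2) * besselJNat n t
    - 1 / Real.pi * ∑' k : ℕ,
        (((harmonic k : ℚ) : ℝ) - Real.eulerMascheroniConstant
          + (((harmonic (n + k) : ℚ) : ℝ) - Real.eulerMascheroniConstant))
        * ((-1 : ℝ) ^ k / ((k ! : ℝ) * ((n + k)! : ℝ))) * (t / 2) ^ (n + 2 * k)

/-- The Hankel function of the first kind `H^{(1)}_m(t) = J_m(t) + i Y_m(t)` of integer order `m`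
at `t > 0`, with `H^{(1)}_{-n} = (-1)^n H^{(1)}_n`. -/
def hankel1 (m : ℤ) (t : ℝ) : ℂ :=
  (if 0 ≤ m then 1 else (-1) ^ m.natAbs) *
    ((besselJNat m.natAbs t : ℂ) + Complex.I * (besselYNat m.natAbs t : ℂ))

/-! ### The background medium -/

/-- The two wave-modes: pressure and shear. -/
inductive WaveMode
  | P
  | S

/-- A homogeneous isotropic elastic background with density `ρ`, Lamé moduli `lam`, `mu`, probed at
angular frequency `ω`; all of these are positive. -/
structure Background where
  ρ : ℝ
  lam : ℝ
  mu : ℝ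
  ω : ℝ
  ρ_pos : 0 < ρ
  lam_pos : 0 < lam
  mu_pos : 0 < mu
  ω_pos : 0 < ω

namespace Background

/-- The wave speeds `c_P = √((λ + 2μ)/ρ)` and `c_S = √(μ/ρ)`. -/
def speed (b : Background) : WaveMode → ℝ
  | .P => Real.sqrt ((b.lam + 2 * b.mu) / b.ρ)
  | .S => Real.sqrt (b.mu / b.ρ)

/-- The wave-numbers `κ_α = ω / c_α`. -/
def waveNumber (b : Background) (α : WaveMode) : ℝ := b.ω / b.speed α

/-- The constants `C_R^α = 2 / (e κ_α R)`. -/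
def CR (b : Background) (α : WaveMode) (R : ℝ) : ℝ :=
  2 / (Real.exp 1 * b.waveNumber α * R)

end Background

/-! ### Outgoing cylindrical elastic waves -/

/-- The Euclidean plane. -/
abbrev Plane : Type := EuclideanSpace ℝ (Fin 2)

/-- The factor `e^{iφ_x} = (x₁ + i x₂)/|x|`, where `φ_x` is the polar angle of `x ≠ 0`. -/
def expPolar (x : Plane) : ℂ := ((x 0 : ℂ) + Complex.I * (x 1 : ℂ)) / ((‖x‖ : ℝ) : ℂ)

/-- The outgoing cylindrical wave function `v_m(x, κ) = H^{(1)}_m(κ|x|) e^{imφ_x}`. -/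
def outgoing (m : ℤ) (κ : ℝ) (x : Plane) : ℂ := hankel1 m (κ * ‖x‖) * expPolar x ^ m

/-- The partial derivative `∂_i f (x)`. -/
def partialDeriv (i : Fin 2) (f : Plane → ℂ) (x : Plane) : ℂ :=
  fderiv ℝ f x (EuclideanSpace.single i 1)

/-- The exterior eigenvectors of the Lamé system, `H^P_m = ∇ v_m(·, κ_P)` and
`H^S_m = (∂₂ v_m(·, κ_S), -∂₁ v_m(·, κ_S))`. -/
def extWave (b : Background) (α : WaveMode) (m : ℤ) (x : Plane) : Fin 2 → ℂ :=
  match α with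
  | .P => ![partialDeriv 0 (outgoing m (b.waveNumber .P)) x,
            partialDeriv 1 (outgoing m (b.waveNumber .P)) x]
  | .S => ![partialDeriv 1 (outgoing m (b.waveNumber .S)) x,
            -partialDeriv 0 (outgoing m (b.waveNumber .S)) x]

/-! ### Acquisition geometry and the matrices `X`, `Y` -/

/-- The angles `2π j / N`, `j = 1, …, N`, of the uniformly distributed sources or receivers. -/
def angle {N : ℕ} (j : Fin N) : ℝ := 2 * Real.pi * (((j : ℕ) : ℝ) + 1) / (N : ℝ)

/-- The unit vector `d = (cos θ, sin θ)`. -/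
def dir (θ : ℝ) : Plane := !₂[Real.cos θ, Real.sin θ]

/-- The unit vector `d^⊥ = (-sin θ, cos θ)` orthogonal to `d`. -/
def dirPerp (θ : ℝ) : Plane := !₂[-Real.sin θ, Real.cos θ]

/-- The modes `m = -K, …, K` that are kept by the cut-off `K`. -/
abbrev Modes (K : ℕ) : Type := ↥(Finset.Icc (-(K : ℤ)) (K : ℤ))

/-- The coefficient `a_m^β = -i/(ρ c_β² κ_β) e^{im(π/2 - θ)}` of the cylindrical expansion of the
plane wave of mode `β` with incidence direction `(cos θ, sin θ)`. -/
def aCoeff (b : Background) (β : WaveMode) (m : ℤ) (θ : ℝ) : ℂ :=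
  -(Complex.I / ((b.ρ * b.speed β ^ 2 * b.waveNumber β : ℝ) : ℂ)) *
    Complex.exp (Complex.I * (m : ℂ) * ((Real.pi / 2 - θ : ℝ) : ℂ))

/-- The coefficient `d_m^β = i a_m^β / (4 ρ ω²)`. -/
def dCoeff (b : Background) (β : WaveMode) (m : ℤ) (θ : ℝ) : ℂ :=
  Complex.I / ((4 * b.ρ * b.ω ^ 2 : ℝ) : ℂ) * aCoeff b β m θ

/-- The matrix `X^β`, with entries `d_m^β(s)`. -/
def XMode (b : Background) (β : WaveMode) (K Ns : ℕ) : Matrix (Fin Ns) (Modes K) ℂ :=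
  Matrix.of fun s m => dCoeff b β m (angle s)

/-- The block matrix `X = diag(X^P, X^S)`. -/
def X (b : Background) (K Ns : ℕ) : Matrix (Fin Ns ⊕ Fin Ns) (Modes K ⊕ Modes K) ℂ :=
  Matrix.fromBlocks (XMode b .P K Ns) 0 0 (XMode b .S K Ns)

/-- The bilinear product `w · d` of a complex vector with a real vector. -/
def dotReal (w : Fin 2 → ℂ) (d : Plane) : ℂ := ∑ i, w i * (d i : ℂ)

/-- The matrix `Y^α_∥`, with entries `conj (H^α_n(x_r)) · d_r`, where `x_r = R d_r`. -/
def YPar (b : Background) (α : WaveMode) (R : ℝ) (K Nr : ℕ) : Matrix (Fin Nr) (Modes K) ℂ :=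
  Matrix.of fun r n =>
    dotReal (star (extWave b α n (R • dir (angle r)))) (dir (angle r))

/-- The matrix `Y^α_⊥`, with entries `conj (H^α_n(x_r)) · d_r^⊥`, where `x_r = R d_r`. -/
def YPerp (b : Background) (α : WaveMode) (R : ℝ) (K Nr : ℕ) : Matrix (Fin Nr) (Modes K) ℂ :=
  Matrix.of fun r n =>
    dotReal (star (extWave b α n (R • dir (angle r)))) (dirPerp (angle r))

/-- The block matrix `Y = (Y^P_∥, Y^S_∥; Y^P_⊥, Y^S_⊥)`. -/
def Y (b : Background) (R : ℝ) (K Nr : ℕ) :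
    Matrix (Fin Nr ⊕ Fin Nr) (Modes K ⊕ Modes K) ℂ :=
  Matrix.fromBlocks (YPar b .P R K Nr) (YPar b .S R K Nr) (YPerp b .P R K Nr) (YPerp b .S R K Nr)

/-! ### The operator `L` and its condition number -/

/-- The linear transformation `L(M) = X M Y*`. -/
def L (b : Background) (R : ℝ) (K Ns Nr : ℕ) :
    Matrix (Modes K ⊕ Modes K) (Modes K ⊕ Modes K) ℂ →ₗ[ℂ]
      Matrix (Fin Ns ⊕ Fin Ns) (Fin Nr ⊕ Fin Nr) ℂ where
  toFun M := X b K Ns * M * (Y b R K Nr)ᴴ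
  map_add' M N := by rw [Matrix.mul_add, Matrix.add_mul]
  map_smul' c M := by rw [Matrix.mul_smul, Matrix.smul_mul, RingHom.id_apply]

/-- Complex matrices as vectors of their entries; the Euclidean inner product on the right is the
Frobenius inner product of matrices. -/
def frobenius (m n : Type) : Matrix m n ℂ ≃ₗ[ℂ] EuclideanSpace ℂ (m × n) where
  toFun M := WithLp.toLp 2 fun p => M p.1 p.2
  invFun v := Matrix.of fun i j => v (i, j)
  left_inv _ := rfl
  right_inv _ := rfl
  map_add' _ _ := rfl
  map_smul' _ _ := rfl

section SingularValues

variable {m n p q : Type} [Fintype m] [Fintype n] [Fintype p] [Fintype q]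

/-- A linear map between spaces of matrices, seen between the Frobenius inner product spaces. -/
def onFrobenius (T : Matrix m n ℂ →ₗ[ℂ] Matrix p q ℂ) :
    EuclideanSpace ℂ (m × n) →ₗ[ℂ] EuclideanSpace ℂ (p × q) :=
  (frobenius p q).toLinearMap ∘ₗ T ∘ₗ (frobenius m n).symm.toLinearMap

/-- The largest singular value, for the Frobenius inner products. -/
def sigmaMax (T : Matrix m n ℂ →ₗ[ℂ] Matrix p q ℂ) : ℝ := (onFrobenius T).singularValues 0

/-- The smallest singular value, for the Frobenius inner products: singular values are listed in
decreasing order with multiplicity, one for each dimension of the domain. -/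
def sigmaMin (T : Matrix m n ℂ →ₗ[ℂ] Matrix p q ℂ) : ℝ :=
  (onFrobenius T).singularValues (Module.finrank ℂ (Matrix m n ℂ) - 1)

/-- The condition number `σ_max / σ_min` (meaningful when `σ_min > 0`). -/
def cond (T : Matrix m n ℂ →ₗ[ℂ] Matrix p q ℂ) : ℝ := sigmaMax T / sigmaMin T

end SingularValues

end

end ElasticMSR

/-! Sampling at `N ≥ 2K + 1` equispaced angles keeps the exponentials of orders `-K, …, K`
orthogonal (`sum_norm_sq_exp_angle`). Hence `X` acts as a multiple of an isometry on each wave-mode,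
and its conditioning is a constant of the medium. In the same way `Y` decouples into 2×2 blocks, one
for each order `m`, built from `t H_n'(t)` and `n H_n(t)` at `s = κ_P R` and `t = κ_S R`, where `n =
|m|`. Since `L` is multiplication by `X` on the left and by `Y*` on the right, it suffices to bound
these blocks from both sides.

Upper bound: the entries are of order `n!/(s/2)^n`, the smaller argument `s` being the worse one;
this is why `κ_P` appears in the result. By Stirling this is `√n (n/(e s/2))^n` up to a constant,
which is `o((C_R^P n)^(n+1))` because the exponent `n + 1` leaves a factor `√n` to spare.

Lower bound: the inverse of a block has Frobenius norm `‖A‖/|det A|`. The determinant never vanishes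
(`hankelDet_ne_zero`), since the Wronskian fixes `Im(t H_n' conj H_n) = 2/π`. For large `n` the
leading terms of the determinant cancel, but the remainder still outgrows the entries
(`tendsto_hankelDet`). So the inverses are bounded uniformly in `n`, by a constant depending on `R`.

The spare factor `√n` absorbs this dependence once `K` is large, so that `C` depends on the medium
only and `R` enters through `K₀`. -/

namespace ElasticMSR

open scoped Matrix Nat
open Filter Topology

noncomputable section

/-! ### Power series with factorially decaying coefficients -/

/-- Coefficients bounded by `C / k!`. -/
def FactorialBound (C : ℝ) (a : ℕ → ℝ) : Prop := ∀ k, |a k| ≤ C / (k ! : ℝ)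

namespace FactorialBound

variable {C : ℝ} {a : ℕ → ℝ}

lemma norm_term_le (h : FactorialBound C a) (z : ℝ) (k : ℕ) :
    ‖a k * z ^ k‖ ≤ C * (|z| ^ k / (k ! : ℝ)) := by
  rw [norm_mul, norm_pow, Real.norm_eq_abs, Real.norm_eq_abs]
  calc |a k| * |z| ^ k ≤ C / (k ! : ℝ) * |z| ^ k := by gcongr; exact h k
    _ = _ := by ring

lemma summable (h : FactorialBound C a) (z : ℝ) : Summable fun k => a k * z ^ k :=
  .of_norm_bounded ((Real.summable_pow_div_factorial |z|).mul_left C) (h.norm_term_le z)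

lemma abs_tsum_le (h : FactorialBound C a) (z : ℝ) :
    |∑' k, a k * z ^ k| ≤ C * Real.exp |z| := by
  have h1 : HasSum (fun k : ℕ => C * (|z| ^ k / (k ! : ℝ))) (C * Real.exp |z|) := by
    refine HasSum.mul_left C ?_
    rw [Real.exp_eq_exp_ℝ]
    exact NormedSpace.expSeries_div_hasSum_exp |z|
  exact tsum_of_norm_bounded h1 (h.norm_term_le z)

lemma tsum_eq_zero_add (h : FactorialBound C a) (z : ℝ) :
    ∑' k, a k * z ^ k = a 0 + z * ∑' k, a (k + 1) * z ^ k := by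
  rw [(h.summable z).tsum_eq_zero_add, ← tsum_mul_left]
  simp only [pow_zero, mul_one]
  congr 1
  exact tsum_congr fun k => by ring

lemma tsum_add_tsum {D : ℝ} {b : ℕ → ℝ} (h : FactorialBound C a) (h' : FactorialBound D b)
    (z : ℝ) : ∑' k, a k * z ^ k + ∑' k, b k * z ^ k = ∑' k, (a k + b k) * z ^ k := by
  rw [← (h.summable z).tsum_add (h'.summable z)]
  exact tsum_congr fun k => by ring

lemma tsum_sub_tsum {D : ℝ} {b : ℕ → ℝ} (h : FactorialBound C a) (h' : FactorialBound D b)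
    (z : ℝ) : ∑' k, a k * z ^ k - ∑' k, b k * z ^ k = ∑' k, (a k - b k) * z ^ k := by
  rw [← (h.summable z).tsum_sub (h'.summable z)]
  exact tsum_congr fun k => by ring

lemma hasDerivAt_tsum (h : FactorialBound C a) (z : ℝ) :
    HasDerivAt (fun z => ∑' k, a k * z ^ k) (∑' k : ℕ, ((k : ℝ) + 1) * a (k + 1) * z ^ k) z := by
  -- Any radius above `|z|` would do: on this ball the differentiated series is dominated by a
  -- shifted exponential series.
  set r : ℝ := |z| + 1
  have hr : 0 < r := by positivity
  have hz : z ∈ Metric.ball (0 : ℝ) r := by simp [r]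
  have hu : Summable fun k : ℕ => C / (k ! : ℝ) * (k * r ^ (k - 1)) := by
    rw [← summable_nat_add_iff 1]
    refine ((Real.summable_pow_div_factorial r).mul_left C).congr fun k => ?_
    rw [Nat.factorial_succ, Nat.add_sub_cancel]
    push_cast
    field_simp
  have key := hasDerivAt_tsum_of_isPreconnected (g := fun k z => a k * z ^ k)
    (g' := fun k z => a k * (k * z ^ (k - 1))) hu Metric.isOpen_ball
    (convex_ball (0 : ℝ) r).isPreconnected (fun k y _ => (hasDerivAt_pow k y).const_mul (a k))
    (fun k y hy => by
      have hy' : |y| ≤ r := by simpa using (Metric.mem_ball.1 hy).le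
      rw [norm_mul, norm_mul, norm_pow, Real.norm_eq_abs, Real.norm_eq_abs, Real.norm_eq_abs,
        Nat.abs_cast]
      exact mul_le_mul (h k) (by gcongr) (by positivity) ((abs_nonneg _).trans (h k))) hz (h.summable z) hz
  refine key.congr_deriv ?_
  have hs : Summable fun k : ℕ => a k * (k * z ^ (k - 1)) := by
    refine .of_norm_bounded hu fun k => ?_
    have hy' : |z| ≤ r := by simp [r]
    rw [norm_mul, norm_mul, norm_pow, Real.norm_eq_abs, Real.norm_eq_abs, Real.norm_eq_abs,
        Nat.abs_cast]
    exact mul_le_mul (h k) (by gcongr) (by positivity) ((abs_nonneg _).trans (h k))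
  rw [hs.tsum_eq_zero_add]
  simp only [Nat.cast_zero, zero_mul, mul_zero, zero_add, Nat.add_sub_cancel]
  exact tsum_congr fun k => by push_cast; ring

end FactorialBound

/-! ### The reduced Bessel functions `(t/2)^(-n) C_n(t)` as functions of `z = (t/2)^2` -/

/-- The coefficients of the power series of the reduced Bessel function. -/
def redJCoeff (n k : ℕ) : ℝ := (-1 : ℝ) ^ k / ((k ! : ℝ) * ((n + k)! : ℝ))

/-- The coefficients of the digamma series of the reduced Neumann function. -/
def redSCoeff (n k : ℕ) : ℝ :=
  (((harmonic k : ℚ) : ℝ) - Real.eulerMascheroniConstant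
    + (((harmonic (n + k) : ℚ) : ℝ) - Real.eulerMascheroniConstant)) * redJCoeff n k

/-- The reduced Bessel function of the first kind. -/
def redJ (n : ℕ) (z : ℝ) : ℝ := ∑' k, redJCoeff n k * z ^ k

/-- The digamma series of the reduced Neumann function. -/
def redS (n : ℕ) (z : ℝ) : ℝ := ∑' k, redSCoeff n k * z ^ k

/-- The principal part of the reduced Neumann function. -/
def redF (n : ℕ) (z : ℝ) : ℝ :=
  ∑ k ∈ Finset.range n, ((n - k - 1)! : ℝ) / (k ! : ℝ) * z ^ ((k : ℤ) - (n : ℤ))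

/-- The reduced Neumann function, or Bessel function of the second kind. -/
def redY (n : ℕ) (z : ℝ) : ℝ :=
  (Real.log z * redJ n z - redF n z - redS n z) / Real.pi

lemma besselJNat_eq (n : ℕ) (t : ℝ) :
    besselJNat n t = (t / 2) ^ n * redJ n ((t / 2) ^ 2) := by
  rw [besselJNat, redJ, ← tsum_mul_left]
  exact tsum_congr fun k => by rw [redJCoeff, pow_add, pow_mul]; ring

lemma besselYNat_eq (n : ℕ) {t : ℝ} (ht : 0 < t) :
    besselYNat n t = (t / 2) ^ n * redY n ((t / 2) ^ 2) := by
  have hx : (t / 2) ≠ 0 := by positivity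
  have h1 : ∑ k ∈ Finset.range n,
      ((n - k - 1)! : ℝ) / (k ! : ℝ) * (t / 2) ^ (2 * (k : ℤ) - (n : ℤ)) =
      (t / 2) ^ n * redF n ((t / 2) ^ 2) := by
    rw [redF, Finset.mul_sum]
    refine Finset.sum_congr rfl fun k _ => ?_
    rw [← zpow_natCast (t / 2) 2, ← zpow_mul, mul_left_comm, ← zpow_natCast (t / 2) n,
      ← zpow_add₀ hx]
    congr 2
    push_cast
    ring
  have h2 : ∑' k : ℕ, (((harmonic k : ℚ) : ℝ) - Real.eulerMascheroniConstant
          + (((harmonic (n + k) : ℚ) : ℝ) - Real.eulerMascheroniConstant))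
        * ((-1 : ℝ) ^ k / ((k ! : ℝ) * ((n + k)! : ℝ))) * (t / 2) ^ (n + 2 * k) =
      (t / 2) ^ n * redS n ((t / 2) ^ 2) := by
    rw [redS, ← tsum_mul_left]
    exact tsum_congr fun k => by rw [redSCoeff, redJCoeff, pow_add, pow_mul]; ring
  -- The factor 2 in `2/π · log (t/2)` is absorbed by `log ((t/2)^2)`.
  rw [besselYNat, h1, h2, besselJNat_eq, redY, Real.log_pow]
  push_cast
  ring

lemma redJCoeff_bound (n : ℕ) : FactorialBound 1 (redJCoeff n) := by
  intro k
  rw [redJCoeff, abs_div, abs_pow, abs_neg, abs_one, one_pow, abs_of_pos (by positivity)]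
  gcongr
  have : (1 : ℝ) ≤ ((n + k)! : ℝ) := by exact_mod_cast Nat.one_le_iff_ne_zero.2 (Nat.factorial_ne_zero _)
  nlinarith [show (0 : ℝ) < (k ! : ℝ) by positivity]

lemma harmonic_nonneg_and_le (n : ℕ) :
    0 ≤ ((harmonic n : ℚ) : ℝ) ∧ ((harmonic n : ℚ) : ℝ) ≤ n := by
  induction n with
  | zero => simp
  | succ n ih =>
    rw [harmonic_succ]
    push_cast
    have h1 : (0 : ℝ) < (n : ℝ) + 1 := by positivity
    have h2 : ((n : ℝ) + 1)⁻¹ ≤ 1 := inv_le_one_of_one_le₀ (by linarith [n.cast_nonneg (α := ℝ)])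
    constructor
    · have := inv_pos.2 h1
      linarith
    · linarith

lemma succ_le_two_mul_factorial (n : ℕ) : n + 1 ≤ 2 * n ! := by
  induction n with
  | zero => simp
  | succ n ih =>
    rw [Nat.factorial_succ]
    rcases Nat.eq_zero_or_pos n with rfl | hn
    · simp
    · nlinarith

/-- Harmonic numbers grow at most linearly, so `(n + k)!` in the denominator absorbs them. That the
constant does not depend on `n` matters for the limit of large orders. -/
lemma redSCoeff_bound (n : ℕ) : FactorialBound 4 (redSCoeff n) := by
  intro k
  have hJ : |redJCoeff n k| = 1 / ((k ! : ℝ) * ((n + k)! : ℝ)) := by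
    rw [redJCoeff, abs_div, abs_pow, abs_neg, abs_one, one_pow, abs_of_pos (by positivity)]
  rw [redSCoeff, abs_mul, hJ]
  have h1 := harmonic_nonneg_and_le k
  have h2 := harmonic_nonneg_and_le (n + k)
  have g1 := Real.one_half_lt_eulerMascheroniConstant
  have g2 := Real.eulerMascheroniConstant_lt_two_thirds
  have hf : ((n + k : ℕ) : ℝ) + 1 ≤ 2 * ((n + k)! : ℝ) := by
    exact_mod_cast succ_le_two_mul_factorial (n + k)
  have hk : (k : ℝ) ≤ ((n + k : ℕ) : ℝ) := by exact_mod_cast Nat.le_add_left k n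
  have hnk : (0 : ℝ) ≤ ((n + k : ℕ) : ℝ) := Nat.cast_nonneg _
  have h3 : |((harmonic k : ℚ) : ℝ) - Real.eulerMascheroniConstant
    + (((harmonic (n + k) : ℚ) : ℝ) - Real.eulerMascheroniConstant)| ≤ 4 * ((n + k)! : ℝ) := by
    rw [abs_le]
    constructor <;> linarith [h1.1, h1.2, h2.1, h2.2]
  calc _ ≤ 4 * ((n + k)! : ℝ) * (1 / ((k ! : ℝ) * ((n + k)! : ℝ))) := by gcongr
    _ = 4 / (k ! : ℝ) := by field_simp

/-! ### Derivatives of the reduced functions raise the order. -/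

lemma hasDerivAt_redJ (n : ℕ) (z : ℝ) : HasDerivAt (redJ n) (-redJ (n + 1) z) z := by
  refine ((redJCoeff_bound n).hasDerivAt_tsum z).congr_deriv ?_
  rw [redJ, ← tsum_neg]
  refine tsum_congr fun k => ?_
  rw [redJCoeff, redJCoeff, show n + (k + 1) = n + 1 + k by ring, Nat.factorial_succ k]
  push_cast
  field_simp
  ring

lemma redJ_eq_add (n : ℕ) (z : ℝ) :
    redJ n z = 1 / (n ! : ℝ) + z * ∑' k, redJCoeff n (k + 1) * z ^ k := by
  rw [redJ, (redJCoeff_bound n).tsum_eq_zero_add]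
  simp [redJCoeff]

lemma redJCoeff_succ_bound (n : ℕ) : FactorialBound 1 fun k => redJCoeff n (k + 1) := by
  intro k
  refine (redJCoeff_bound n (k + 1)).trans ?_
  gcongr
  omega

lemma redSCoeff_succ_bound (n : ℕ) : FactorialBound 4 fun k => redSCoeff n (k + 1) := by
  intro k
  refine (redSCoeff_bound n (k + 1)).trans ?_
  gcongr
  omega

/-- The extra term comes from `harmonic (k + 1) - harmonic k = 1/(k + 1)`. In `hasDerivAt_redY` it
cancels against the derivative of `log z` and the extra term of `hasDerivAt_redF`. -/
lemma hasDerivAt_redS (n : ℕ) {z : ℝ} (hz : z ≠ 0) :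
    HasDerivAt (redS n) (-redS (n + 1) z + (redJ n z - 1 / (n ! : ℝ)) / z) z := by
  refine ((redSCoeff_bound n).hasDerivAt_tsum z).congr_deriv ?_
  rw [redJ_eq_add, add_sub_cancel_left, mul_div_cancel_left₀ _ hz, redS, neg_add_eq_sub,
    (redJCoeff_succ_bound n).tsum_sub_tsum (redSCoeff_bound (n + 1))]
  refine tsum_congr fun k => ?_
  simp only [redSCoeff]
  rw [redJCoeff, redJCoeff, show n + (k + 1) = n + 1 + k by ring, Nat.factorial_succ k,
    harmonic_succ]
  push_cast
  field_simp
  ring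

lemma hasDerivAt_redF (n : ℕ) {z : ℝ} (hz : z ≠ 0) :
    HasDerivAt (redF n) (-redF (n + 1) z + 1 / (n ! : ℝ) / z) z := by
  have h := HasDerivAt.fun_sum (u := Finset.range n) fun k _ =>
    (hasDerivAt_zpow ((k : ℤ) - (n : ℤ)) z (Or.inl hz)).const_mul
      (((n - k - 1)! : ℝ) / (k ! : ℝ))
  refine h.congr_deriv ?_
  symm
  rw [redF, Finset.sum_range_succ, neg_add, add_assoc, ← Finset.sum_neg_distrib]
  -- The last term of `redF (n + 1)` is not the derivative of any term of `redF n`; it is exactly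
  -- the correction.
  have h0 : -((((n + 1 - n - 1)! : ℕ) : ℝ) / (n ! : ℝ) * z ^ ((n : ℤ) - ((n + 1 : ℕ) : ℤ))) +
      1 / (n ! : ℝ) / z = 0 := by
    rw [show (n : ℤ) - ((n + 1 : ℕ) : ℤ) = -1 by push_cast; ring, zpow_neg_one]
    simp
    ring
  rw [h0, add_zero]
  refine Finset.sum_congr rfl fun k hk => ?_
  obtain ⟨d, rfl⟩ : ∃ d, n = k + 1 + d := ⟨n - (k + 1), by have := Finset.mem_range.1 hk; omega⟩
  rw [show k + 1 + d + 1 - k - 1 = d + 1 by omega, show k + 1 + d - k - 1 = d by omega,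
    Nat.factorial_succ,
    show (k : ℤ) - ((k + 1 + d + 1 : ℕ) : ℤ) = (k : ℤ) - ((k + 1 + d : ℕ) : ℤ) - 1 by
      push_cast; ring]
  push_cast
  ring

lemma hasDerivAt_redY (n : ℕ) {z : ℝ} (hz : z ≠ 0) :
    HasDerivAt (redY n) (-redY (n + 1) z) z := by
  refine (((((Real.hasDerivAt_log hz).mul (hasDerivAt_redJ n z)).sub
    (hasDerivAt_redF n hz)).sub (hasDerivAt_redS n hz)).div_const Real.pi).congr_deriv ?_
  rw [redY]
  field_simp
  ring

/-! ### Three-term recurrences in the order. -/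

lemma redJ_recurrence (n : ℕ) (z : ℝ) :
    redJ n z + z * redJ (n + 2) z = (n + 1) * redJ (n + 1) z := by
  rw [redJ_eq_add n, redJ_eq_add (n + 1), redJ, add_assoc, ← mul_add,
    (redJCoeff_succ_bound n).tsum_add_tsum (redJCoeff_bound (n + 2)), mul_add,
    mul_left_comm ((n : ℝ) + 1), ← tsum_mul_left (a := (n : ℝ) + 1)]
  congr 1
  · rw [Nat.factorial_succ]
    push_cast
    field_simp
  · congr 1
    refine tsum_congr fun k => ?_
    rw [redJCoeff, redJCoeff, redJCoeff, show n + (k + 1) = n + k + 1 by ring,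
      show n + 2 + k = n + k + 1 + 1 by ring, show n + 1 + (k + 1) = n + k + 1 + 1 by ring,
      Nat.factorial_succ k, Nat.factorial_succ (n + k + 1), Nat.factorial_succ (n + k)]
    push_cast
    field_simp
    ring

lemma redS_eq_add (n : ℕ) (z : ℝ) :
    redS n z = redSCoeff n 0 + z * ∑' k, redSCoeff n (k + 1) * z ^ k :=
  (redSCoeff_bound n).tsum_eq_zero_add z

/-- The defect `1/(n + 1)!` is opposite to that of `redF_recurrence`, so `redY` satisfies the same
recurrence as `redJ`. -/
lemma redS_recurrence (n : ℕ) (z : ℝ) :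
    redS n z + z * redS (n + 2) z = (n + 1) * redS (n + 1) z - 1 / ((n + 1)! : ℝ) := by
  rw [redS_eq_add n, redS_eq_add (n + 1), redS, add_assoc, ← mul_add,
    (redSCoeff_succ_bound n).tsum_add_tsum (redSCoeff_bound (n + 2)), mul_add,
    mul_left_comm ((n : ℝ) + 1), ← tsum_mul_left (a := (n : ℝ) + 1), add_sub_right_comm]
  congr 1
  · simp only [redSCoeff, redJCoeff, add_zero]
    rw [harmonic_succ, Nat.factorial_succ]
    push_cast
    field_simp
    ring
  · congr 1
    refine tsum_congr fun k => ?_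
    simp only [redSCoeff]
    rw [redJCoeff, redJCoeff, redJCoeff, show n + (k + 1) = n + k + 1 by ring,
      show n + 2 + k = n + k + 1 + 1 by ring, show n + 1 + (k + 1) = n + k + 1 + 1 by ring,
      Nat.factorial_succ k, Nat.factorial_succ (n + k + 1), Nat.factorial_succ (n + k),
      harmonic_succ k, harmonic_succ (n + k + 1)]
    push_cast
    field_simp
    ring

lemma redF_recurrence (n : ℕ) {z : ℝ} (hz : z ≠ 0) :
    redF n z + z * redF (n + 2) z = (n + 1) * redF (n + 1) z + 1 / ((n + 1)! : ℝ) := by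
  have h1 : z * redF (n + 2) z = (∑ k ∈ Finset.range (n + 1), ((n + 1 - k)! : ℝ) / (k ! : ℝ) *
      z ^ ((k : ℤ) - ((n + 1 : ℕ) : ℤ))) + 1 / ((n + 1)! : ℝ) := by
    have hzz : ∀ k : ℕ, z * z ^ ((k : ℤ) - ((n + 2 : ℕ) : ℤ)) =
        z ^ ((k : ℤ) - ((n + 1 : ℕ) : ℤ)) := fun k => by
      rw [← zpow_one_add₀ hz]
      congr 1
      push_cast
      ring
    rw [redF, Finset.mul_sum, Finset.sum_range_succ]
    congr 1
    · refine Finset.sum_congr rfl fun k _ => ?_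
      rw [mul_left_comm, hzz, show n + 2 - k - 1 = n + 1 - k by omega]
    · rw [mul_left_comm, hzz]
      simp
  -- The factor `k` makes an added term at `k = 0` vanish, so all sums share one range and one power
  -- of `z`.
  have h2 : redF n z = ∑ k ∈ Finset.range (n + 1), (k : ℝ) * ((n - k)! : ℝ) / (k ! : ℝ) *
      z ^ ((k : ℤ) - ((n + 1 : ℕ) : ℤ)) := by
    rw [Finset.sum_range_succ', redF]
    simp only [Nat.cast_zero, zero_mul, zero_div, add_zero]
    refine Finset.sum_congr rfl fun k _ => ?_
    rw [Nat.factorial_succ, Nat.sub_sub,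
      show ((k + 1 : ℕ) : ℤ) - ((n + 1 : ℕ) : ℤ) = (k : ℤ) - (n : ℤ) by push_cast; ring]
    push_cast
    field_simp
  rw [h1, h2, ← add_assoc, ← Finset.sum_add_distrib, redF, Finset.mul_sum]
  congr 1
  refine Finset.sum_congr rfl fun k hk => ?_
  obtain ⟨d, rfl⟩ : ∃ d, n = k + d := ⟨n - k, by have := Finset.mem_range.1 hk; omega⟩
  rw [show k + d + 1 - k - 1 = d by omega, show k + d - k = d by omega,
    show k + d + 1 - k = d + 1 by omega, Nat.factorial_succ]
  push_cast
  ring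

lemma redY_recurrence (n : ℕ) {z : ℝ} (hz : z ≠ 0) :
    redY n z + z * redY (n + 2) z = (n + 1) * redY (n + 1) z := by
  have h1 := redJ_recurrence n z
  have h2 := redF_recurrence n hz
  have h3 := redS_recurrence n z
  simp only [redY]
  field_simp
  linear_combination (Real.log z) * h1 - h2 - h3

/-! ### Large orders -/

/-- The constant term `1/n!` dominates: `(n + 1) n! ≤ (n + k + 1)!` makes the rest of relative size
`1/(n + 1)`. -/
lemma tendsto_factorial_mul_redJ (z : ℝ) :
    Tendsto (fun n : ℕ => (n ! : ℝ) * redJ n z) atTop (𝓝 1) := by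
  have hb : ∀ n : ℕ, FactorialBound 1 fun k => (n + 1) * (n ! : ℝ) * redJCoeff n (k + 1) := by
    intro n k
    have hp : (0 : ℝ) < (n + 1) * (n ! : ℝ) := by positivity
    simp only [redJCoeff]
    rw [abs_mul, abs_div, abs_pow, abs_neg, abs_one, one_pow, abs_of_pos hp,
      abs_of_pos (by positivity), mul_one_div]
    have h1 : ((n : ℝ) + 1) * (n ! : ℝ) ≤ ((n + (k + 1))! : ℝ) := by
      have := Nat.factorial_le (show n + 1 ≤ n + (k + 1) by omega)
      rw [Nat.factorial_succ] at this
      exact_mod_cast this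
    have h2 : (k ! : ℝ) ≤ ((k + 1)! : ℝ) := by exact_mod_cast Nat.factorial_le (by omega)
    rw [div_le_div_iff₀ (by positivity) (by positivity)]
    nlinarith [mul_le_mul h1 h2 (by positivity) (by positivity)]
  have h : ∀ n : ℕ, ‖(n ! : ℝ) * redJ n z - 1‖ ≤ |z| * Real.exp |z| * (1 / ((n : ℝ) + 1)) := by
    intro n
    have h1 := (hb n).abs_tsum_le z
    rw [one_mul] at h1
    have h2 : (n ! : ℝ) * redJ n z - 1 =
        z * (∑' k, (n + 1) * (n ! : ℝ) * redJCoeff n (k + 1) * z ^ k) * (1 / ((n : ℝ) + 1)) := by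
      simp_rw [mul_assoc _ (redJCoeff n _)]
      rw [redJ_eq_add, tsum_mul_left]
      field_simp
      ring
    rw [h2, norm_mul, norm_mul, Real.norm_eq_abs, Real.norm_eq_abs, Real.norm_of_nonneg (by positivity)]
    gcongr
  have h0 : Tendsto (fun n : ℕ => (n ! : ℝ) * redJ n z - 1) atTop (𝓝 0) :=
    squeeze_zero_norm h (by
      simpa using tendsto_one_div_add_atTop_nhds_zero_nat.const_mul (|z| * Real.exp |z|))
  simpa using h0.add_const 1

lemma tendsto_redF {z : ℝ} (hz : 0 < z) :
    Tendsto (fun n : ℕ => z ^ (n + 1) / (n ! : ℝ) * redF (n + 1) z) atTop (𝓝 1) := by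
  have h1 : ∀ n : ℕ, z ^ (n + 1) / (n ! : ℝ) * redF (n + 1) z =
      ∑ k ∈ Finset.range (n + 1), ((n - k)! : ℝ) / ((n ! : ℝ) * (k ! : ℝ)) * z ^ k := by
    intro n
    rw [redF, Finset.mul_sum]
    refine Finset.sum_congr rfl fun k _ => ?_
    rw [show n + 1 - k - 1 = n - k by omega, zpow_sub₀ hz.ne', zpow_natCast, zpow_natCast]
    field_simp
  have h2 : ∀ n : ℕ, 1 ≤ n → ‖z ^ (n + 1) / (n ! : ℝ) * redF (n + 1) z - 1‖ ≤
      Real.exp z * (1 / (n : ℝ)) := by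
    intro n hn
    have hn' : (0 : ℝ) < n := by exact_mod_cast hn
    rw [h1, Finset.sum_range_succ']
    simp only [Nat.sub_zero, Nat.factorial_zero, Nat.cast_one, mul_one, pow_zero]
    rw [div_self (by positivity), add_sub_cancel_right, Real.norm_of_nonneg (by positivity)]
    calc _ ≤ ∑ k ∈ Finset.range n, z ^ (k + 1) / ((k + 1)! : ℝ) * (1 / (n : ℝ)) := by
          refine Finset.sum_le_sum fun k hk => ?_
          have h3 : ((n - (k + 1))! : ℝ) * n ≤ (n ! : ℝ) := by
            have := Nat.factorial_le (show n - (k + 1) ≤ n - 1 by omega)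
            rw [← Nat.mul_factorial_pred (by omega : n ≠ 0), mul_comm]
            push_cast
            gcongr
          have h4 : ((n - (k + 1))! : ℝ) / (n ! : ℝ) ≤ 1 / n := by
            rw [div_le_div_iff₀ (by positivity) hn']
            linarith
          calc _ = z ^ (k + 1) / ((k + 1)! : ℝ) * (((n - (k + 1))! : ℝ) / (n ! : ℝ)) := by
                field_simp
            _ ≤ _ := by gcongr
      _ = (∑ k ∈ Finset.range n, z ^ (k + 1) / ((k + 1)! : ℝ)) * (1 / (n : ℝ)) := by
          rw [Finset.sum_mul]
      _ ≤ _ := by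
          gcongr
          refine le_trans ?_ (Real.sum_le_exp_of_nonneg hz.le (n + 1))
          rw [Finset.sum_range_succ']
          simp
  have h0 : Tendsto (fun n : ℕ => z ^ (n + 1) / (n ! : ℝ) * redF (n + 1) z - 1) atTop (𝓝 0) :=
    squeeze_zero_norm' (eventually_atTop.2 ⟨1, h2⟩) (by
      simpa using tendsto_one_div_atTop_nhds_zero_nat.const_mul (Real.exp z))
  simpa using h0.add_const 1

lemma tendsto_pow_succ_div_factorial_mul (z : ℝ) {f : ℕ → ℝ} {B : ℝ} (hf : ∀ n, |f n| ≤ B) :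
    Tendsto (fun n : ℕ => z ^ (n + 1) / (n ! : ℝ) * f n) atTop (𝓝 0) := by
  have h0 := (FloorSemiring.tendsto_pow_div_factorial_atTop z).const_mul z
  rw [mul_zero] at h0
  refine (h0.zero_mul_isBoundedUnder_le (g := f) ?_).congr fun n => by ring
  exact isBoundedUnder_of ⟨B, hf⟩

/-- Only the principal part survives, through its `k = 0` term; the other two parts stay bounded in
`n`. -/
lemma tendsto_redY {z : ℝ} (hz : 0 < z) :
    Tendsto (fun n : ℕ => z ^ (n + 1) / (n ! : ℝ) * redY (n + 1) z) atTop
      (𝓝 (-(1 / Real.pi))) := by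
  have hJ := tendsto_pow_succ_div_factorial_mul z (f := fun n => redJ (n + 1) z)
    fun n => (redJCoeff_bound (n + 1)).abs_tsum_le z
  have hS := tendsto_pow_succ_div_factorial_mul z (f := fun n => redS (n + 1) z)
    fun n => (redSCoeff_bound (n + 1)).abs_tsum_le z
  have h := (((hJ.const_mul (Real.log z)).sub (tendsto_redF hz)).sub hS).div_const Real.pi
  convert h using 1
  · ext n
    rw [redY]
    ring
  · congr 1
    ring

/-- The Wronskian relation for the reduced Bessel functions. -/
lemma redWronskian (n : ℕ) {z : ℝ} (hz : 0 < z) :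
    z ^ (n + 1) * (redJ (n + 1) z * redY n z - redJ n z * redY (n + 1) z) = 1 / Real.pi := by
  -- The recurrences make the expression independent of the order, so its value is its limit at
  -- infinite order; no differential equation is needed.
  have hstep : ∀ n : ℕ,
      z ^ (n + 2) * (redJ (n + 2) z * redY (n + 1) z - redJ (n + 1) z * redY (n + 2) z) =
      z ^ (n + 1) * (redJ (n + 1) z * redY n z - redJ n z * redY (n + 1) z) := fun n => by
    linear_combination z ^ (n + 1) * redY (n + 1) z * redJ_recurrence n z -
      z ^ (n + 1) * redJ (n + 1) z * redY_recurrence n hz.ne'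
  have hconst : ∀ m : ℕ,
      z ^ (n + m + 1) * (redJ (n + m + 1) z * redY (n + m) z - redJ (n + m) z * redY (n + m + 1) z)
      = z ^ (n + 1) * (redJ (n + 1) z * redY n z - redJ n z * redY (n + 1) z) := by
    intro m
    induction m with
    | zero => rfl
    | succ m ih => exact (hstep (n + m)).trans ih
  have hlim : Tendsto (fun m : ℕ =>
      z ^ (m + 1) * (redJ (m + 1) z * redY m z - redJ m z * redY (m + 1) z)) atTop
      (𝓝 (1 / Real.pi)) := by
    rw [← tendsto_add_atTop_iff_nat 1]
    have hJ := tendsto_factorial_mul_redJ z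
    have hY := tendsto_redY hz
    have hJ1 := (tendsto_add_atTop_iff_nat 1).2 hJ
    have hJ2 := (tendsto_add_atTop_iff_nat 2).2 hJ
    have hY1 := (tendsto_add_atTop_iff_nat 1).2 hY
    have hi := tendsto_one_div_add_atTop_nhds_zero_nat (𝕜 := ℝ)
    have hi1 := (tendsto_add_atTop_iff_nat 1).2 hi
    -- The first product is smaller by two factors of order `1/m`; the second tends to `-1/π`.
    have h := ((((hJ2.mul hY).mul hi).mul hi1).const_mul z).sub (hJ1.mul hY1)
    convert h using 1
    · ext m
      simp only [Nat.factorial_succ]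
      push_cast
      field_simp
      ring
    · congr 1
      ring
  have h2 := hlim.comp (tendsto_add_atTop_nat n)
  have h3 : (fun m : ℕ =>
      z ^ (m + 1) * (redJ (m + 1) z * redY m z - redJ m z * redY (m + 1) z)) ∘ (fun m => m + n) =
      fun _ => z ^ (n + 1) * (redJ (n + 1) z * redY n z - redJ n z * redY (n + 1) z) := by
    ext m
    rw [Function.comp_apply, ← hconst m, add_comm n m]
  rw [h3] at h2
  exact tendsto_nhds_unique tendsto_const_nhds h2

/-! ### Hankel functions of natural order -/

/-- The Hankel function `H_n = J_n + i Y_n` of order `n ≥ 0`. -/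
def hankelNat (n : ℕ) (t : ℝ) : ℂ := (besselJNat n t : ℂ) + Complex.I * (besselYNat n t : ℂ)

/-- The function `t H_n'(t) = n H_n(t) - t H_{n+1}(t)`. -/
def hankelRad (n : ℕ) (t : ℝ) : ℂ := n * hankelNat n t - t * hankelNat (n + 1) t

lemma hasDerivAt_pow_mul_comp_sq (n : ℕ) {t : ℝ} (ht : 0 < t) {f : ℝ → ℝ} {g : ℝ}
    (hf : HasDerivAt f (-g) ((t / 2) ^ 2)) :
    HasDerivAt (fun t => (t / 2) ^ n * f ((t / 2) ^ 2))
      (n / t * ((t / 2) ^ n * f ((t / 2) ^ 2)) - (t / 2) ^ (n + 1) * g) t := by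
  have hx : HasDerivAt (fun t : ℝ => t / 2) (1 / 2) t := (hasDerivAt_id t).div_const 2
  refine ((hx.fun_pow n).mul (hf.comp t (hx.fun_pow 2))).congr_deriv ?_
  -- At `n = 0` the truncated exponent is harmless, as both sides vanish.
  have hpow : (n : ℝ) * (t / 2) ^ (n - 1) = n / t * (2 * (t / 2) ^ n) := by
    rcases n with _ | n
    · simp
    · rw [Nat.add_sub_cancel, pow_succ]
      field_simp
  simp only [Function.comp_apply]
  rw [hpow]
  ring

lemma hasDerivAt_besselJNat (n : ℕ) {t : ℝ} (ht : 0 < t) :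
    HasDerivAt (besselJNat n) (n / t * besselJNat n t - besselJNat (n + 1) t) t := by
  have h := hasDerivAt_pow_mul_comp_sq n ht (hasDerivAt_redJ n ((t / 2) ^ 2))
  rw [← besselJNat_eq, ← besselJNat_eq] at h
  exact h.congr_of_eventuallyEq (Eventually.of_forall fun t => besselJNat_eq n t)

lemma hasDerivAt_besselYNat (n : ℕ) {t : ℝ} (ht : 0 < t) :
    HasDerivAt (besselYNat n) (n / t * besselYNat n t - besselYNat (n + 1) t) t := by
  have h := hasDerivAt_pow_mul_comp_sq n ht
    (hasDerivAt_redY n (z := (t / 2) ^ 2) (by positivity))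
  rw [← besselYNat_eq n ht, ← besselYNat_eq (n + 1) ht] at h
  refine h.congr_of_eventuallyEq ?_
  filter_upwards [lt_mem_nhds ht] with s hs using besselYNat_eq n hs

lemma hasDerivAt_hankelNat (n : ℕ) {t : ℝ} (ht : 0 < t) :
    HasDerivAt (hankelNat n) (hankelRad n t / t) t := by
  refine ((hasDerivAt_besselJNat n ht).ofReal_comp.add
    ((hasDerivAt_besselYNat n ht).ofReal_comp.const_mul Complex.I)).congr_deriv ?_
  have ht' : (t : ℂ) ≠ 0 := by exact_mod_cast ht.ne'
  simp only [hankelRad, hankelNat]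
  push_cast
  field_simp
  ring

lemma hankelNat_recurrence (n : ℕ) {t : ℝ} (ht : 0 < t) :
    t * (hankelNat n t + hankelNat (n + 2) t) = 2 * (n + 1) * hankelNat (n + 1) t := by
  have hz : (t / 2) ^ 2 ≠ 0 := by positivity
  have hJ : t * (besselJNat n t + besselJNat (n + 2) t) =
      2 * (n + 1) * besselJNat (n + 1) t := by
    simp only [besselJNat_eq]
    linear_combination t * (t / 2) ^ n * redJ_recurrence n ((t / 2) ^ 2)
  have hY : t * (besselYNat n t + besselYNat (n + 2) t) =
      2 * (n + 1) * besselYNat (n + 1) t := by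
    simp only [besselYNat_eq _ ht]
    linear_combination t * (t / 2) ^ n * redY_recurrence n hz
  have hJ' : (t : ℂ) * (besselJNat n t + besselJNat (n + 2) t) =
      2 * (n + 1) * besselJNat (n + 1) t := by exact_mod_cast congrArg Complex.ofReal hJ
  have hY' : (t : ℂ) * (besselYNat n t + besselYNat (n + 2) t) =
      2 * (n + 1) * besselYNat (n + 1) t := by exact_mod_cast congrArg Complex.ofReal hY
  simp only [hankelNat]
  linear_combination hJ' + Complex.I * hY'

lemma hankelRad_succ (n : ℕ) {t : ℝ} (ht : 0 < t) :
    hankelRad (n + 1) t = t * hankelNat n t - (n + 1) * hankelNat (n + 1) t := by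
  rw [hankelRad]
  push_cast
  linear_combination -hankelNat_recurrence n ht

/-- The Wronskian of `J_n` and `Y_n`. -/
lemma bessel_wronskian (n : ℕ) {t : ℝ} (ht : 0 < t) :
    t * (besselJNat (n + 1) t * besselYNat n t - besselJNat n t * besselYNat (n + 1) t) =
      2 / Real.pi := by
  have h := redWronskian n (z := (t / 2) ^ 2) (by positivity)
  simp only [besselJNat_eq, besselYNat_eq _ ht]
  rw [← pow_mul] at h
  rw [show 2 / Real.pi = 2 * (1 / Real.pi) by ring, ← h, mul_add, pow_add]
  ring

/-- This is the Wronskian read as the outgoing energy flux: it depends neither on the order nor on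
the argument. -/
lemma im_hankelRad_mul_conj (n : ℕ) {t : ℝ} (ht : 0 < t) :
    (hankelRad n t * (starRingEnd ℂ) (hankelNat n t)).im = 2 / Real.pi := by
  rw [← bessel_wronskian n ht]
  simp [hankelRad, hankelNat]
  ring

/-- The determinant of the `n`-th Fourier block of the exterior elastic waves. -/
def hankelDet (n : ℕ) (s t : ℝ) : ℂ :=
  hankelRad n s * hankelRad n t - n ^ 2 * hankelNat n s * hankelNat n t

/-- If it vanished, `u v` below would be real and nonnegative. But `u` and `v` have the same
imaginary part `2/π`, so `Im (u v) = 0` forces `v = -conj u`, and then `u v = -|u|² < 0`. -/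
lemma hankelDet_ne_zero (n : ℕ) {s t : ℝ} (hs : 0 < s) (ht : 0 < t) : hankelDet n s t ≠ 0 := by
  intro h
  have h1 := im_hankelRad_mul_conj n hs
  have h2 := im_hankelRad_mul_conj n ht
  set u := hankelRad n s * (starRingEnd ℂ) (hankelNat n s) with hu
  set v := hankelRad n t * (starRingEnd ℂ) (hankelNat n t) with hv
  have huv : u * v = ((n ^ 2 * Complex.normSq (hankelNat n s) *
      Complex.normSq (hankelNat n t) : ℝ) : ℂ) := by
    push_cast
    rw [← Complex.mul_conj, ← Complex.mul_conj, hu, hv]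
    rw [hankelDet] at h
    linear_combination (starRingEnd ℂ) (hankelNat n s) * (starRingEnd ℂ) (hankelNat n t) * h
  have hre := congrArg Complex.re huv
  have him := congrArg Complex.im huv
  rw [Complex.ofReal_re, Complex.mul_re, h1, h2] at hre
  rw [Complex.ofReal_im, Complex.mul_im, h1, h2] at him
  have hpi : 0 < 2 / Real.pi := by positivity
  have hsum : u.re + v.re = 0 := by
    have : (2 / Real.pi) * (u.re + v.re) = 0 := by linarith
    exact (mul_eq_zero.1 this).resolve_left hpi.ne'
  have hnn : 0 ≤ (n : ℝ) ^ 2 * Complex.normSq (hankelNat n s) * Complex.normSq (hankelNat n t) := by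
    have := Complex.normSq_nonneg (hankelNat n s)
    have := Complex.normSq_nonneg (hankelNat n t)
    positivity
  have hv' : v.re = -u.re := by linarith
  rw [hv'] at hre
  nlinarith [mul_pos hpi hpi, mul_self_nonneg u.re]

/-! ### Hankel functions of large order -/

lemma tendsto_hankelNat {t : ℝ} (ht : 0 < t) :
    Tendsto (fun n : ℕ => ((t / 2) ^ (n + 1) / (n ! : ℝ) : ℝ) * hankelNat (n + 1) t) atTop
      (𝓝 (-(Complex.I / Real.pi))) := by
  have hz : 0 < (t / 2) ^ 2 := by positivity
  have hJ := (tendsto_pow_succ_div_factorial_mul ((t / 2) ^ 2)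
    (f := fun n => redJ (n + 1) ((t / 2) ^ 2))
    fun n => (redJCoeff_bound (n + 1)).abs_tsum_le _).ofReal
  have hY := (tendsto_redY hz).ofReal.const_mul Complex.I
  convert hJ.add hY using 1
  · ext n
    rw [hankelNat, besselJNat_eq, besselYNat_eq _ ht]
    push_cast
    rw [← pow_mul, show 2 * (n + 1) = (n + 1) + (n + 1) by ring, pow_add (_ / _ : ℂ) (n + 1)]
    ring
  · congr 1
    push_cast
    ring

lemma tendsto_mul_hankelNat {t : ℝ} (ht : 0 < t) :
    Tendsto (fun n : ℕ => ((t / 2) ^ n / (n ! : ℝ) : ℝ) * (n * hankelNat n t)) atTop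
      (𝓝 (-(Complex.I / Real.pi))) := by
  rw [← tendsto_add_atTop_iff_nat 1]
  refine (tendsto_hankelNat ht).congr fun n => ?_
  have h : ((n ! : ℕ) : ℂ) ≠ 0 := by exact_mod_cast Nat.factorial_ne_zero n
  have h' : ((n : ℂ) + 1) ≠ 0 := by exact_mod_cast Nat.succ_ne_zero n
  rw [Nat.factorial_succ]
  push_cast
  field_simp

lemma tendsto_ofReal_one_div_add_one :
    Tendsto (fun n : ℕ => ((1 / ((n : ℝ) + 1) : ℝ) : ℂ)) atTop (𝓝 0) := by
  simpa using (tendsto_one_div_add_atTop_nhds_zero_nat (𝕜 := ℝ)).ofReal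

lemma tendsto_hankelRad {t : ℝ} (ht : 0 < t) :
    Tendsto (fun n : ℕ => ((t / 2) ^ n / (n ! : ℝ) : ℝ) * hankelRad n t) atTop
      (𝓝 (Complex.I / Real.pi)) := by
  rw [← tendsto_add_atTop_iff_nat 2]
  have hi := tendsto_ofReal_one_div_add_one
  have hi1 := (tendsto_add_atTop_iff_nat 1).2 hi
  have hG := tendsto_hankelNat ht
  have hG1 := (tendsto_add_atTop_iff_nat 1).2 hG
  have h := (((hG.mul hi).mul hi1).const_mul ((t : ℂ) ^ 2 / 2)).sub hG1
  convert h using 1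
  · ext n
    rw [hankelRad_succ _ ht, Nat.factorial_succ (n + 1), Nat.factorial_succ n]
    have h : ((n ! : ℕ) : ℂ) ≠ 0 := by exact_mod_cast Nat.factorial_ne_zero n
    have h' : ((n : ℂ) + 1) ≠ 0 := by exact_mod_cast Nat.succ_ne_zero n
    have h'' : ((n : ℂ) + 1 + 1) ≠ 0 := by exact_mod_cast Nat.succ_ne_zero (n + 1)
    push_cast
    field_simp
    ring
  · congr 1
    ring

/-- Writing the radial terms by `hankelRad_succ` cancels the leading product `(n + 2)² H_{n+2}(s)
H_{n+2}(t)` exactly. The mixed products of orders `n + 1` and `n + 2` give the limit. -/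
lemma tendsto_hankelDet {s t : ℝ} (hs : 0 < s) (ht : 0 < t) :
    Tendsto (fun n : ℕ => ((s / 2) ^ (n + 2) * (t / 2) ^ (n + 2) / ((n + 1)! : ℝ) ^ 2 : ℝ) *
      hankelDet (n + 2) s t) atTop (𝓝 (((s ^ 2 + t ^ 2) / (2 * Real.pi ^ 2) : ℝ) : ℂ)) := by
  have hi := tendsto_ofReal_one_div_add_one
  have hs0 := tendsto_hankelNat hs
  have hs1 := (tendsto_add_atTop_iff_nat 1).2 hs0
  have ht0 := tendsto_hankelNat ht
  have ht1 := (tendsto_add_atTop_iff_nat 1).2 ht0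
  have h := ((((hs0.mul hi).mul (ht0.mul hi)).const_mul ((s : ℂ) ^ 2 * t ^ 2 / 4))).sub
    ((((hs0.mul ht1).const_mul ((s : ℂ) ^ 2 / 2)).add
      ((ht0.mul hs1).const_mul ((t : ℂ) ^ 2 / 2))).mul (hi.const_add 1))
  convert h using 1
  · ext n
    rw [hankelDet, hankelRad_succ _ hs, hankelRad_succ _ ht, Nat.factorial_succ n]
    have h : ((n ! : ℕ) : ℂ) ≠ 0 := by exact_mod_cast Nat.factorial_ne_zero n
    have h' : ((n : ℂ) + 1) ≠ 0 := by exact_mod_cast Nat.succ_ne_zero n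
    push_cast
    field_simp
    ring
  · congr 1
    have hpi : (Real.pi : ℂ) ≠ 0 := by exact_mod_cast Real.pi_ne_zero
    push_cast
    field_simp
    ring_nf
    rw [Complex.I_sq]
    ring

/-- The squared Frobenius norm of the `n`-th Fourier block of the exterior elastic waves. -/
def hankelSq (n : ℕ) (s t : ℝ) : ℝ :=
  ‖hankelRad n s‖ ^ 2 + ‖hankelRad n t‖ ^ 2 + ‖(n : ℂ) * hankelNat n s‖ ^ 2 +
    ‖(n : ℂ) * hankelNat n t‖ ^ 2

lemma hankelSq_nonneg (n : ℕ) (s t : ℝ) : 0 ≤ hankelSq n s t := by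
  rw [hankelSq]; positivity

lemma eventually_norm_le_of_tendsto {t : ℝ} (ht : 0 < t) {f : ℕ → ℂ} {l : ℂ} (hl : ‖l‖ < 1)
    (h : Tendsto (fun n : ℕ => ((t / 2) ^ n / (n ! : ℝ) : ℝ) * f n) atTop (𝓝 l)) :
    ∀ᶠ n : ℕ in atTop, ‖f n‖ ≤ (n ! : ℝ) / (t / 2) ^ n := by
  filter_upwards [h.norm.eventually_lt_const hl] with n hn
  rw [norm_mul, Complex.norm_real, Real.norm_of_nonneg (by positivity)] at hn
  rw [le_div_iff₀ (by positivity)]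
  rw [div_mul_eq_mul_div, div_lt_one (by positivity)] at hn
  linarith

lemma eventually_hankelSq_le {s t : ℝ} (hs : 0 < s) (hst : s ≤ t) :
    ∀ᶠ n : ℕ in atTop, hankelSq n s t ≤ (2 * ((n ! : ℝ) / (s / 2) ^ n)) ^ 2 := by
  have ht := hs.trans_le hst
  have hl : ‖Complex.I / (Real.pi : ℂ)‖ < 1 := by
    rw [norm_div, Complex.norm_I, Complex.norm_real, Real.norm_of_nonneg Real.pi_pos.le,
      div_lt_one Real.pi_pos]
    linarith [Real.pi_gt_three]
  filter_upwards [eventually_norm_le_of_tendsto hs hl (tendsto_hankelRad hs),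
    eventually_norm_le_of_tendsto ht hl (tendsto_hankelRad ht),
    eventually_norm_le_of_tendsto hs (by rwa [norm_neg]) (tendsto_mul_hankelNat hs),
    eventually_norm_le_of_tendsto ht (by rwa [norm_neg]) (tendsto_mul_hankelNat ht)]
    with n h1 h2 h3 h4
  have h : (n ! : ℝ) / (t / 2) ^ n ≤ (n ! : ℝ) / (s / 2) ^ n := by gcongr
  have h2' := h2.trans h
  have h4' := h4.trans h
  rw [hankelSq]
  calc _ ≤ ((n ! : ℝ) / (s / 2) ^ n) ^ 2 + ((n ! : ℝ) / (s / 2) ^ n) ^ 2 +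
        ((n ! : ℝ) / (s / 2) ^ n) ^ 2 + ((n ! : ℝ) / (s / 2) ^ n) ^ 2 := by gcongr
    _ = _ := by ring

/-- In other words, the inverse blocks eventually have Frobenius norm at most 1. Despite its
cancellation the determinant exceeds the entries by about `n!/(t/2)^n`, up to powers of `n`. -/
lemma eventually_hankelSq_le_hankelDet {s t : ℝ} (hs : 0 < s) (hst : s ≤ t) :
    ∀ᶠ n : ℕ in atTop, hankelSq n s t ≤ ‖hankelDet n s t‖ ^ 2 := by
  have ht := hs.trans_le hst
  set c : ℝ := (s ^ 2 + t ^ 2) / (2 * Real.pi ^ 2) with hc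
  have hcpos : 0 < c := by positivity
  have hD : ∀ᶠ n : ℕ in atTop, c / 2 < ‖((s / 2) ^ (n + 2) * (t / 2) ^ (n + 2) /
      ((n + 1)! : ℝ) ^ 2 : ℝ) * hankelDet (n + 2) s t‖ := by
    refine (tendsto_hankelDet hs ht).norm.eventually_const_lt ?_
    rw [Complex.norm_real, Real.norm_of_nonneg hcpos.le]
    linarith
  have hsmall : ∀ᶠ n : ℕ in atTop,
      (1 + 1 / ((n : ℝ) + 1)) * ((t / 2) ^ 2 * ((t / 2) ^ n / (n ! : ℝ))) < c / 4 := by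
    have h := ((tendsto_one_div_add_atTop_nhds_zero_nat (𝕜 := ℝ)).const_add 1).mul
      ((FloorSemiring.tendsto_pow_div_factorial_atTop (t / 2)).const_mul ((t / 2) ^ 2))
    refine h.eventually_lt_const ?_
    simpa using hcpos
  have hS := (tendsto_add_atTop_nat 2).eventually (eventually_hankelSq_le hs hst)
  rw [← map_add_atTop_eq_nat 2, eventually_map]
  filter_upwards [hD, hsmall, hS] with n h1 h2 h3
  refine h3.trans ?_
  rw [norm_mul, Complex.norm_real, Real.norm_of_nonneg (by positivity)] at h1
  have hf : (0 : ℝ) < ((n + 1)! : ℝ) := by positivity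
  have ha : 0 < (s / 2) ^ (n + 2) := by positivity
  have hb : 0 < (t / 2) ^ (n + 2) := by positivity
  have h4 : 4 * ((n : ℝ) + 2) * (t / 2) ^ (n + 2) ≤ c * ((n + 1)! : ℝ) := by
    have h5 : (1 + 1 / ((n : ℝ) + 1)) * ((t / 2) ^ 2 * ((t / 2) ^ n / (n ! : ℝ))) =
        ((n : ℝ) + 2) * (t / 2) ^ (n + 2) / ((n + 1)! : ℝ) := by
      rw [Nat.factorial_succ]
      push_cast
      field_simp
      ring
    rw [h5, div_lt_iff₀ hf] at h2
    linarith
  gcongr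
  rw [mul_div_assoc', div_le_iff₀ ha, Nat.factorial_succ (n + 1)]
  push_cast
  rw [div_mul_eq_mul_div, lt_div_iff₀ (by positivity)] at h1
  have h6 : 2 * ((n : ℝ) + 2) * ((n + 1)! : ℝ) * ((t / 2) ^ (n + 2) * ((n + 1)! : ℝ)) ≤
      ‖hankelDet (n + 2) s t‖ * (s / 2) ^ (n + 2) * ((t / 2) ^ (n + 2) * ((n + 1)! : ℝ)) := by
    have h7 := mul_le_mul_of_nonneg_right h4 (by positivity : 0 ≤ ((n + 1)! : ℝ) ^ 2)
    have h9 := mul_le_mul_of_nonneg_right h1.le hf.le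
    linarith
  have h8 := le_of_mul_le_mul_right h6 (by positivity)
  linarith

/-- The `n`-th Fourier block is uniformly invertible. -/
lemma exists_hankelSq_le {s t : ℝ} (hs : 0 < s) (hst : s ≤ t) :
    ∃ B : ℝ, 0 < B ∧ ∀ n, hankelSq n s t ≤ B * ‖hankelDet n s t‖ ^ 2 := by
  have hpos : ∀ n, 0 < ‖hankelDet n s t‖ ^ 2 := fun n => by
    have := norm_pos_iff.2 (hankelDet_ne_zero n hs (hs.trans_le hst))
    positivity
  obtain ⟨N, hN⟩ := eventually_atTop.1 (eventually_hankelSq_le_hankelDet hs hst)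
  have hsum : ∀ n, 0 ≤ hankelSq n s t / ‖hankelDet n s t‖ ^ 2 := fun n =>
    div_nonneg (hankelSq_nonneg n s t) (hpos n).le
  -- The 1 serves the tail, the sum the finitely many remaining orders.
  refine ⟨1 + ∑ n ∈ Finset.range N, hankelSq n s t / ‖hankelDet n s t‖ ^ 2,
    add_pos_of_pos_of_nonneg one_pos (Finset.sum_nonneg fun n _ => hsum n), fun n => ?_⟩
  rw [← div_le_iff₀ (hpos n)]
  rcases le_or_gt N n with h | h
  · have h1 := (div_le_one (hpos n)).2 (hN n h)
    have h2 := Finset.sum_nonneg fun n (_ : n ∈ Finset.range N) => hsum n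
    linarith
  · have h2 := Finset.single_le_sum (fun n _ => hsum n) (Finset.mem_range.2 h)
    linarith

/-- Stirling yields `√n (n/(e x))^n` up to a constant; the additional factor `n/(e x)` on the right
beats `√n`, whatever `ε` is. -/
lemma eventually_factorial_le {x : ℝ} (hx : 0 < x) {ε : ℝ} (hε : 0 < ε) :
    ∀ᶠ n : ℕ in atTop, (n ! : ℝ) / x ^ n ≤ ε * (1 / (Real.exp 1 * x) * n) ^ (n + 1) := by
  have hpi : √Real.pi < 2 := by
    rw [Real.sqrt_lt' two_pos]
    linarith [Real.pi_lt_four]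
  have hlim : Tendsto (fun n : ℕ => √(n : ℝ)) atTop atTop :=
    Real.tendsto_sqrt_atTop.comp tendsto_natCast_atTop_atTop
  filter_upwards [Stirling.tendsto_stirlingSeq_sqrt_pi.eventually_lt_const hpi,
    hlim.eventually_ge_atTop (2 * √2 * Real.exp 1 * x / ε), eventually_gt_atTop 0] with n h1 h2 h3
  have hn : (0 : ℝ) < n := by exact_mod_cast h3
  rw [Stirling.stirlingSeq, div_lt_iff₀ (by positivity)] at h1
  rw [div_le_iff₀ hε] at h2
  have hsq : √(n : ℝ) * √(n : ℝ) = n := Real.mul_self_sqrt hn.le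
  rw [div_le_iff₀ (by positivity)]
  refine h1.le.trans ?_
  have h4 : ε * (1 / (Real.exp 1 * x) * n) ^ (n + 1) * x ^ n =
      (√(n : ℝ) * ε) * (√(n : ℝ) * (n / Real.exp 1) ^ n / (Real.exp 1 * x)) := by
    have h5 : (1 / (Real.exp 1 * x) * n) ^ (n + 1) * x ^ n =
        (n / Real.exp 1) ^ n * (n / (Real.exp 1 * x)) := by
      have h6 : 1 / (Real.exp 1 * x) * n * x = n / Real.exp 1 := by field_simp
      rw [pow_succ, mul_right_comm, ← mul_pow, h6, one_div_mul_eq_div]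
    rw [mul_assoc, h5]
    nth_rw 2 [← hsq]
    ring
  rw [h4]
  refine le_trans (le_of_eq ?_) (mul_le_mul_of_nonneg_right h2 (by positivity))
  rw [Real.sqrt_mul zero_le_two]
  field_simp

lemma mul_pow_succ_le_of_le {c : ℝ} (hc : 0 < c) {m n : ℕ} (hm : 1 ≤ c * m) (hmn : m ≤ n) :
    (c * m) ^ (m + 1) ≤ (c * n) ^ (n + 1) := by
  have h : c * m ≤ c * n := by gcongr
  calc (c * m) ^ (m + 1) ≤ (c * n) ^ (m + 1) := by gcongr
    _ ≤ _ := pow_le_pow_right₀ (hm.trans h) (by omega)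

lemma eventually_forall_hankelSq_le {s t : ℝ} (hs : 0 < s) (hst : s ≤ t) {ε : ℝ} (hε : 0 < ε) :
    ∀ᶠ K : ℕ in atTop, ∀ n ≤ K,
      hankelSq n s t ≤ (ε * (2 / (Real.exp 1 * s) * K) ^ (K + 1)) ^ 2 := by
  set c : ℝ := 2 / (Real.exp 1 * s) with hc
  have hcpos : 0 < c := by positivity
  have hcn : Tendsto (fun n : ℕ => c * (n : ℝ)) atTop atTop :=
    tendsto_natCast_atTop_atTop.const_mul_atTop hcpos
  -- Here `ε/2` offsets the factor 2 of `eventually_hankelSq_le`. Orders below `N` are bounded by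
  -- the constant `M`, which is overtaken since `c K → ∞`.
  obtain ⟨N, hN⟩ := eventually_atTop.1 ((eventually_hankelSq_le hs hst).and
    ((eventually_factorial_le (half_pos hs) (half_pos hε)).and (hcn.eventually_ge_atTop 1)))
  have hcs : 1 / (Real.exp 1 * (s / 2)) = c := by rw [hc]; field_simp
  rw [hcs] at hN
  set M : ℝ := ∑ n ∈ Finset.range N, hankelSq n s t with hM
  have hMnn : 0 ≤ M := Finset.sum_nonneg fun n _ => hankelSq_nonneg n s t
  filter_upwards [eventually_ge_atTop N, hcn.eventually_ge_atTop ((M + 1) / ε)] with K hK hK' n hn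
  have h1 : 1 ≤ c * (K : ℝ) := (hN K hK).2.2
  rcases le_or_gt N n with h | h
  · obtain ⟨h2, h3, h4⟩ := hN n h
    refine h2.trans ?_
    have h5 := mul_pow_succ_le_of_le hcpos h4 hn
    refine pow_le_pow_left₀ (by positivity) ?_ 2
    calc 2 * ((n ! : ℝ) / (s / 2) ^ n) ≤ 2 * (ε / 2 * (c * n) ^ (n + 1)) := by gcongr
      _ = ε * (c * n) ^ (n + 1) := by ring
      _ ≤ _ := by gcongr
  · have h2 : hankelSq n s t ≤ M :=
      Finset.single_le_sum (fun n _ => hankelSq_nonneg n s t) (Finset.mem_range.2 h)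
    have h3 : M + 1 ≤ ε * (c * K) ^ (K + 1) := by
      rw [div_le_iff₀ hε] at hK'
      have : c * (K : ℝ) ≤ (c * K) ^ (K + 1) := le_self_pow₀ h1 (by omega)
      nlinarith
    calc hankelSq n s t ≤ (M + 1) ^ 2 := by nlinarith
      _ ≤ _ := pow_le_pow_left₀ (by positivity) h3 2

/-! ### Hankel functions of integer order -/

/-- The sign relating the orders `m` and `|m|`. -/
def hankelSign (m : ℤ) : ℂ := if 0 ≤ m then 1 else (-1) ^ m.natAbs

lemma norm_hankelSign (m : ℤ) : ‖hankelSign m‖ = 1 := by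
  rw [hankelSign]
  split_ifs <;> simp

lemma hankel1_eq (m : ℤ) (t : ℝ) : hankel1 m t = hankelSign m * hankelNat m.natAbs t := rfl

lemma hasDerivAt_hankel1 (m : ℤ) {t : ℝ} (ht : 0 < t) :
    HasDerivAt (hankel1 m) (hankelSign m * (hankelRad m.natAbs t / t)) t :=
  (hasDerivAt_hankelNat m.natAbs ht).const_mul (hankelSign m)

/-! ### The exterior waves in polar coordinates -/

lemma Background.speed_pos (b : Background) (α : WaveMode) : 0 < b.speed α := by
  have := b.ρ_pos
  have := b.lam_pos
  have := b.mu_pos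
  cases α <;> exact Real.sqrt_pos.2 (by positivity)

lemma Background.waveNumber_pos (b : Background) (α : WaveMode) : 0 < b.waveNumber α :=
  div_pos b.ω_pos (b.speed_pos α)

lemma Background.waveNumber_P_le_S (b : Background) : b.waveNumber .P ≤ b.waveNumber .S := by
  have := b.ρ_pos
  have := b.lam_pos
  have := b.mu_pos
  refine div_le_div_of_nonneg_left b.ω_pos.le (b.speed_pos .S) (Real.sqrt_le_sqrt ?_)
  gcongr
  linarith

lemma dir_eq (θ : ℝ) : dir θ = Real.cos θ • EuclideanSpace.single 0 1 +
    Real.sin θ • EuclideanSpace.single 1 1 := by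
  ext i
  fin_cases i <;> simp [dir]

lemma dirPerp_eq (θ : ℝ) : dirPerp θ = -Real.sin θ • EuclideanSpace.single 0 1 +
    Real.cos θ • EuclideanSpace.single 1 1 := by
  ext i
  fin_cases i <;> simp [dirPerp]

lemma norm_smul_dir {r : ℝ} (hr : 0 ≤ r) (θ : ℝ) : ‖r • dir θ‖ = r := by
  have h : ‖dir θ‖ = 1 := by
    rw [EuclideanSpace.norm_eq]
    simp [dir]
  rw [norm_smul, h, mul_one, Real.norm_of_nonneg hr]

lemma hasDerivAt_dir (θ : ℝ) : HasDerivAt dir (dirPerp θ) θ := by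
  have h := ((Real.hasDerivAt_cos θ).smul_const (EuclideanSpace.single (0 : Fin 2) (1 : ℝ))).add
    ((Real.hasDerivAt_sin θ).smul_const (EuclideanSpace.single (1 : Fin 2) (1 : ℝ)))
  rw [← dirPerp_eq] at h
  exact h.congr_of_eventuallyEq (Eventually.of_forall dir_eq)

lemma expPolar_smul_dir {r : ℝ} (hr : 0 < r) (θ : ℝ) :
    expPolar (r • dir θ) = Complex.exp (θ * Complex.I) := by
  have hr' : (r : ℂ) ≠ 0 := by exact_mod_cast hr.ne'
  rw [expPolar, norm_smul_dir hr.le, Complex.exp_mul_I, div_eq_iff hr']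
  simp [dir]
  ring

lemma outgoing_smul_dir (m : ℤ) (κ : ℝ) {r : ℝ} (hr : 0 < r) (θ : ℝ) :
    outgoing m κ (r • dir θ) = hankel1 m (κ * r) * Complex.exp (m * (θ * Complex.I)) := by
  rw [outgoing, norm_smul_dir hr.le, expPolar_smul_dir hr, Complex.exp_int_mul]

lemma differentiableAt_outgoing (m : ℤ) {κ : ℝ} (hκ : 0 < κ) {x : Plane} (hx : x ≠ 0) :
    DifferentiableAt ℝ (outgoing m κ) x := by
  have hn : 0 < ‖x‖ := norm_pos_iff.2 hx
  have hnorm : DifferentiableAt ℝ (fun y : Plane => ‖y‖) x := differentiableAt_id.norm ℝ hx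
  have hH : DifferentiableAt ℝ (hankel1 m) (κ * ‖x‖) :=
    (hasDerivAt_hankel1 m (mul_pos hκ hn)).differentiableAt
  have h1 : DifferentiableAt ℝ (fun y : Plane => hankel1 m (κ * ‖y‖)) x :=
    DifferentiableAt.comp (g := hankel1 m) x hH (hnorm.const_mul κ)
  have hc : ∀ i, DifferentiableAt ℝ (fun y : Plane => ((y i : ℝ) : ℂ)) x := fun i =>
    Complex.ofRealCLM.differentiableAt.comp (f := fun y : Plane => y i) x
      (by fun_prop)
  have hne : ((‖x‖ : ℝ) : ℂ) ≠ 0 := by exact_mod_cast hn.ne'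
  have hnc : DifferentiableAt ℝ (fun y : Plane => ((‖y‖ : ℝ) : ℂ)) x :=
    Complex.ofRealCLM.differentiableAt.comp (f := fun y : Plane => ‖y‖) x hnorm
  have hE : DifferentiableAt ℝ expPolar x :=
    ((hc 0).add ((hc 1).const_mul Complex.I)).mul (hnc.inv hne)
  -- Needed for the negative powers `m`.
  have hE0 : expPolar x ≠ 0 := by
    refine div_ne_zero (fun h => hx ?_) hne
    have h0 := congrArg Complex.re h
    have h1 := congrArg Complex.im h
    simp at h0 h1
    ext i
    fin_cases i
    · simpa using h0
    · simpa using h1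
  have hz : DifferentiableAt ℝ (fun w : ℂ => w ^ m) (expPolar x) :=
    (differentiableAt_zpow.2 (Or.inl hE0)).restrictScalars ℝ
  exact h1.mul (hz.comp x hE)

lemma smul_dir_ne_zero {R : ℝ} (hR : 0 < R) (θ : ℝ) : R • dir θ ≠ 0 := by
  rw [← norm_pos_iff, norm_smul_dir hR.le]
  exact hR

/-- The common angular factor of the components of the waves of order `m`. -/
def phase (m : ℤ) (θ : ℝ) : ℂ := hankelSign m * Complex.exp (m * (θ * Complex.I))

lemma fderiv_outgoing_dir (m : ℤ) {κ R : ℝ} (hκ : 0 < κ) (hR : 0 < R) (θ : ℝ) :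
    fderiv ℝ (outgoing m κ) (R • dir θ) (dir θ) =
      phase m θ * (hankelRad m.natAbs (κ * R) / R) := by
  have hline : HasDerivAt (fun r : ℝ => r • dir θ) (dir θ) R := by
    simpa using (hasDerivAt_id R).smul_const (dir θ)
  have h1 := (differentiableAt_outgoing m hκ (smul_dir_ne_zero hR θ)).hasFDerivAt.comp_hasDerivAt
    R hline
  have h2 : HasDerivAt (fun r : ℝ => hankel1 m (κ * r) * Complex.exp (m * (θ * Complex.I)))
      (phase m θ * (hankelRad m.natAbs (κ * R) / R)) R := by
    have h3 := (hasDerivAt_hankel1 m (mul_pos hκ hR)).scomp R ((hasDerivAt_id R).const_mul κ)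
    refine (h3.mul_const (Complex.exp (m * (θ * Complex.I)))).congr_deriv ?_
    have hκ' : (κ : ℂ) ≠ 0 := by exact_mod_cast hκ.ne'
    have hR' : (R : ℂ) ≠ 0 := by exact_mod_cast hR.ne'
    rw [phase, mul_one, Complex.real_smul]
    push_cast
    field_simp
  refine h1.unique (h2.congr_of_eventuallyEq ?_)
  filter_upwards [lt_mem_nhds hR] with r hr using outgoing_smul_dir m κ hr θ

lemma fderiv_outgoing_dirPerp (m : ℤ) {κ R : ℝ} (hκ : 0 < κ) (hR : 0 < R) (θ : ℝ) :
    fderiv ℝ (outgoing m κ) (R • dir θ) (dirPerp θ) =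
      phase m θ * (Complex.I * m * hankelNat m.natAbs (κ * R) / R) := by
  have hR' : (R : ℂ) ≠ 0 := by exact_mod_cast hR.ne'
  have h1 := (differentiableAt_outgoing m hκ (smul_dir_ne_zero hR θ)).hasFDerivAt.comp_hasDerivAt
    θ ((hasDerivAt_dir θ).const_smul R)
  have h2 : HasDerivAt (fun θ : ℝ => hankel1 m (κ * R) * Complex.exp (m * (θ * Complex.I)))
      (phase m θ * (Complex.I * m * hankelNat m.natAbs (κ * R))) θ := by
    have h3 := ((((Complex.ofRealCLM.hasDerivAt (x := θ)).mul_const Complex.I).const_mul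
      (m : ℂ)).cexp).const_mul (hankel1 m (κ * R))
    refine h3.congr_deriv ?_
    rw [phase, hankel1_eq]
    simp
    ring
  have h3 := h1.unique (h2.congr_of_eventuallyEq
    (Eventually.of_forall fun θ => outgoing_smul_dir m κ hR θ))
  -- The circle of radius `R` is traversed with velocity `R • dirPerp θ`, hence the division by `R`.
  rw [map_smul, Complex.real_smul] at h3
  rw [mul_div_assoc', ← h3, mul_div_cancel_left₀ _ hR']

lemma partialDeriv_mul_cos_add (f : Plane → ℂ) (x : Plane) (θ : ℝ) :
    partialDeriv 0 f x * Real.cos θ + partialDeriv 1 f x * Real.sin θ =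
      fderiv ℝ f x (dir θ) := by
  rw [dir_eq, map_add, map_smul, map_smul, Complex.real_smul, Complex.real_smul]
  simp only [partialDeriv]
  ring

lemma partialDeriv_mul_sin_add (f : Plane → ℂ) (x : Plane) (θ : ℝ) :
    -(partialDeriv 0 f x * Real.sin θ) + partialDeriv 1 f x * Real.cos θ =
      fderiv ℝ f x (dirPerp θ) := by
  rw [dirPerp_eq, map_add, map_smul, map_smul, Complex.real_smul, Complex.real_smul]
  simp only [partialDeriv]
  push_cast
  ring

lemma dotReal_star (w : Fin 2 → ℂ) (d : Plane) :
    dotReal (star w) d = (starRingEnd ℂ) (dotReal w d) := by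
  simp [dotReal, Fin.sum_univ_two]

lemma dotReal_extWave_P_dir (b : Background) (m : ℤ) {R : ℝ} (hR : 0 < R) (θ : ℝ) :
    dotReal (extWave b .P m (R • dir θ)) (dir θ) =
      phase m θ * (hankelRad m.natAbs (b.waveNumber .P * R) / R) := by
  rw [← fderiv_outgoing_dir m (b.waveNumber_pos .P) hR, ← partialDeriv_mul_cos_add]
  simp [dotReal, extWave, dir]

lemma dotReal_extWave_P_dirPerp (b : Background) (m : ℤ) {R : ℝ} (hR : 0 < R) (θ : ℝ) :
    dotReal (extWave b .P m (R • dir θ)) (dirPerp θ) =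
      phase m θ * (Complex.I * m * hankelNat m.natAbs (b.waveNumber .P * R) / R) := by
  rw [← fderiv_outgoing_dirPerp m (b.waveNumber_pos .P) hR, ← partialDeriv_mul_sin_add]
  simp [dotReal, extWave, dirPerp]

/-- The shear wave is a gradient turned by a right angle, so radial and angular derivatives exchange
roles, with one sign. -/
lemma dotReal_extWave_S_dir (b : Background) (m : ℤ) {R : ℝ} (hR : 0 < R) (θ : ℝ) :
    dotReal (extWave b .S m (R • dir θ)) (dir θ) =
      phase m θ * (Complex.I * m * hankelNat m.natAbs (b.waveNumber .S * R) / R) := by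
  rw [← fderiv_outgoing_dirPerp m (b.waveNumber_pos .S) hR, ← partialDeriv_mul_sin_add]
  simp [dotReal, extWave, dir]
  ring

lemma dotReal_extWave_S_dirPerp (b : Background) (m : ℤ) {R : ℝ} (hR : 0 < R) (θ : ℝ) :
    dotReal (extWave b .S m (R • dir θ)) (dirPerp θ) =
      phase m θ * -(hankelRad m.natAbs (b.waveNumber .S * R) / R) := by
  rw [mul_neg, ← fderiv_outgoing_dir m (b.waveNumber_pos .S) hR, ← partialDeriv_mul_cos_add]
  simp [dotReal, extWave, dirPerp]

/-! ### Frobenius norms and singular values -/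

section Frobenius

variable {m n p q : Type} [Fintype m] [Fintype n] [Fintype p] [Fintype q]

/-- The squared Frobenius norm. -/
def frobSq (M : Matrix m n ℂ) : ℝ := ∑ i, ∑ j, ‖M i j‖ ^ 2

lemma frobSq_conjTranspose (M : Matrix m n ℂ) : frobSq Mᴴ = frobSq M := by
  rw [frobSq, frobSq, Finset.sum_comm]
  simp

lemma norm_frobenius_sq (M : Matrix m n ℂ) : ‖frobenius m n M‖ ^ 2 = frobSq M := by
  rw [EuclideanSpace.norm_sq_eq, Fintype.sum_prod_type]
  rfl

lemma frobSq_mul (A : Matrix p m ℂ) (M : Matrix m n ℂ) :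
    frobSq (A * M) = ∑ j, ∑ i, ‖(A *ᵥ fun k => M k j) i‖ ^ 2 := by
  rw [frobSq, Finset.sum_comm]
  rfl

lemma mul_frobSq_le {A : Matrix p m ℂ} {l : ℝ}
    (h : ∀ v : m → ℂ, l * ∑ k, ‖v k‖ ^ 2 ≤ ∑ i, ‖(A *ᵥ v) i‖ ^ 2) (M : Matrix m n ℂ) :
    l * frobSq M ≤ frobSq (A * M) := by
  rw [frobSq_mul, frobSq, Finset.sum_comm, Finset.mul_sum]
  exact Finset.sum_le_sum fun j _ => h fun k => M k j

lemma frobSq_mul_le {A : Matrix p m ℂ} {u : ℝ}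
    (h : ∀ v : m → ℂ, ∑ i, ‖(A *ᵥ v) i‖ ^ 2 ≤ u * ∑ k, ‖v k‖ ^ 2) (M : Matrix m n ℂ) :
    frobSq (A * M) ≤ u * frobSq M := by
  have hu : u * frobSq M = ∑ j, u * ∑ k, ‖M k j‖ ^ 2 := by
    rw [frobSq, Finset.sum_comm, Finset.mul_sum]
  rw [frobSq_mul, hu]
  exact Finset.sum_le_sum fun j _ => h fun k => M k j

/-- An eigenvector of `T* T` for `σ_i²`. Testing a bound valid for all matrices on it replaces a
min-max principle. -/
lemma exists_frobSq_eq (T : Matrix m n ℂ →ₗ[ℂ] Matrix p q ℂ) {i : ℕ}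
    (hi : i < Module.finrank ℂ (Matrix m n ℂ)) :
    ∃ M : Matrix m n ℂ, 0 < frobSq M ∧
      frobSq (T M) = (onFrobenius T).singularValues i ^ 2 * frobSq M := by
  have hi' : i < Module.finrank ℂ (EuclideanSpace ℂ (m × n)) := by
    rwa [← (frobenius m n).finrank_eq]
  obtain ⟨v, hv⟩ :=
    ((onFrobenius T).hasEigenvalue_adjoint_comp_self_sq_singularValues hi').exists_hasEigenvector
  have hv0 : 0 < ‖v‖ := norm_pos_iff.2 hv.2
  have hv1 := hv.apply_eq_smul
  have hnorm : ‖(onFrobenius T) v‖ ^ 2 = (onFrobenius T).singularValues i ^ 2 * ‖v‖ ^ 2 := by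
    have h1 : inner ℂ v ((LinearMap.adjoint (onFrobenius T) ∘ₗ onFrobenius T) v) =
        ((‖(onFrobenius T) v‖ ^ 2 : ℝ) : ℂ) := by
      rw [LinearMap.comp_apply, LinearMap.adjoint_inner_right, inner_self_eq_norm_sq_to_K]
      push_cast
      rfl
    rw [hv1, inner_smul_right, inner_self_eq_norm_sq_to_K] at h1
    refine Complex.ofReal_injective (h1.symm.trans ?_)
    push_cast
    rfl
  have hF : ‖(onFrobenius T) v‖ ^ 2 = frobSq (T ((frobenius m n).symm v)) := by
    rw [← norm_frobenius_sq]
    rfl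
  have hvF : ‖v‖ ^ 2 = frobSq ((frobenius m n).symm v) := by
    rw [← norm_frobenius_sq, LinearEquiv.apply_symm_apply]
  refine ⟨(frobenius m n).symm v, ?_, ?_⟩
  · rw [← hvF]
    positivity
  · rw [← hF, ← hvF, hnorm]

lemma sq_sigmaMax_le [Nonempty m] [Nonempty n] {T : Matrix m n ℂ →ₗ[ℂ] Matrix p q ℂ} {u : ℝ}
    (h : ∀ M, frobSq (T M) ≤ u * frobSq M) : sigmaMax T ^ 2 ≤ u := by
  obtain ⟨M, hM, hTM⟩ := exists_frobSq_eq T (i := 0) Module.finrank_pos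
  exact le_of_mul_le_mul_right (hTM ▸ h M) hM

lemma le_sq_sigmaMin [Nonempty m] [Nonempty n] {T : Matrix m n ℂ →ₗ[ℂ] Matrix p q ℂ} {l : ℝ}
    (h : ∀ M, l * frobSq M ≤ frobSq (T M)) : l ≤ sigmaMin T ^ 2 := by
  obtain ⟨M, hM, hTM⟩ := exists_frobSq_eq T
    (Nat.sub_lt (Module.finrank_pos (R := ℂ) (M := Matrix m n ℂ)) one_pos)
  exact le_of_mul_le_mul_right (hTM ▸ h M) hM

end Frobenius

/-! ### Orthogonality of the discrete exponentials -/

lemma sum_exp_angle {N : ℕ} {k : ℤ} (hk : |k| < N) :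
    ∑ j : Fin N, Complex.exp (-(k * (angle j * Complex.I))) = if k = 0 then (N : ℂ) else 0 := by
  split_ifs with h0
  · simp [h0]
  have hN : (N : ℂ) ≠ 0 := by
    have : (0 : ℤ) < N := (abs_nonneg k).trans_lt hk
    exact_mod_cast this.ne'
  set w : ℂ := Complex.exp (-(k * (2 * Real.pi * Complex.I / N))) with hw
  have hw1 : w ≠ 1 := by
    intro h
    obtain ⟨n, hn⟩ := Complex.exp_eq_one_iff.1 h
    have hpi : (2 * Real.pi * Complex.I : ℂ) ≠ 0 := Complex.two_pi_I_ne_zero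
    have h1 : (-(k : ℂ)) = n * N := by
      field_simp at hn
      have h2 : (2 * Real.pi * Complex.I : ℂ) * (-(k : ℂ)) = 2 * Real.pi * Complex.I * (n * N) := by
        linear_combination (2 * Real.pi * Complex.I) * hn
      exact mul_left_cancel₀ hpi h2
    have h2 : -k = n * N := by exact_mod_cast h1
    have h3 : (N : ℤ) ∣ k := ⟨-n, by linarith⟩
    exact h0 (Int.eq_zero_of_abs_lt_dvd h3 hk)
  have hwN : w ^ N = 1 := by
    rw [hw, ← Complex.exp_nat_mul, Complex.exp_eq_one_iff]
    refine ⟨-k, ?_⟩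
    push_cast
    field_simp
  -- The angles start at `j + 1`, hence the extra factor `w` in front of the geometric sum.
  have hterm : ∀ j : Fin N, Complex.exp (-(k * (angle j * Complex.I))) = w * w ^ (j : ℕ) := by
    intro j
    rw [← pow_succ', hw, ← Complex.exp_nat_mul]
    congr 1
    rw [angle]
    push_cast
    field_simp
  simp_rw [hterm]
  rw [← Finset.mul_sum, Fin.sum_univ_eq_sum_range (fun j => w ^ j) N, geom_sum_eq hw1, hwN]
  simp

/-- Discrete Parseval identity: orders differ by at most `2K < N`, so distinct modes are not
aliased. -/
lemma sum_norm_sq_exp_angle {K N : ℕ} (hN : 2 * K + 1 ≤ N) (g : Modes K → ℂ) :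
    ∑ j : Fin N, ‖∑ m : Modes K, Complex.exp (-((m : ℤ) * (angle j * Complex.I))) * g m‖ ^ 2 =
      N * ∑ m, ‖g m‖ ^ 2 := by
  have hexp : ∀ (m m' : Modes K) (j : Fin N),
      Complex.exp (-((m : ℤ) * (angle j * Complex.I))) * g m *
        (starRingEnd ℂ) (Complex.exp (-((m' : ℤ) * (angle j * Complex.I))) * g m') =
      Complex.exp (-(((m : ℤ) - (m' : ℤ) : ℤ) * (angle j * Complex.I))) *
        (g m * (starRingEnd ℂ) (g m')) := by
    intro m m' j
    have h : Complex.exp (-(((m : ℤ) - (m' : ℤ) : ℤ) * (angle j * Complex.I))) =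
        Complex.exp (-((m : ℤ) * (angle j * Complex.I))) *
          Complex.exp ((m' : ℤ) * (angle j * Complex.I)) := by
      rw [← Complex.exp_add]
      congr 1
      push_cast
      ring
    rw [h, map_mul, ← Complex.exp_conj]
    simp
    ring
  have key : ∑ j : Fin N, ((‖∑ m : Modes K, Complex.exp (-((m : ℤ) * (angle j * Complex.I))) *
      g m‖ ^ 2 : ℝ) : ℂ) = ((N * ∑ m, ‖g m‖ ^ 2 : ℝ) : ℂ) := by
    simp_rw [Complex.ofReal_pow, ← Complex.mul_conj', map_sum, Finset.sum_mul_sum, hexp]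
    rw [Finset.sum_comm]
    rw [Complex.ofReal_mul, Complex.ofReal_natCast, Complex.ofReal_sum, Finset.mul_sum]
    refine Finset.sum_congr rfl fun m _ => ?_
    rw [Finset.sum_comm, Finset.sum_eq_single m]
    · rw [← Finset.sum_mul, sum_exp_angle (by simp; omega), if_pos (sub_self _), Complex.mul_conj',
        Complex.ofReal_pow]
    · intro m' _ hm'
      have h1 := Finset.mem_Icc.1 m.2
      have h2 := Finset.mem_Icc.1 m'.2
      have h3 : |(m : ℤ) - (m' : ℤ)| < N := by
        rw [abs_lt]
        omega
      rw [← Finset.sum_mul, sum_exp_angle h3, if_neg, zero_mul]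
      intro h
      exact hm' (Subtype.ext (by omega))
    · simp
  exact_mod_cast key

/-! ### Two-by-two blocks -/

lemma norm_sq_add_le (p q x y : ℂ) :
    ‖p * x + q * y‖ ^ 2 ≤ (‖p‖ ^ 2 + ‖q‖ ^ 2) * (‖x‖ ^ 2 + ‖y‖ ^ 2) := by
  have h := norm_add_le (p * x) (q * y)
  rw [norm_mul, norm_mul] at h
  calc _ ≤ (‖p‖ * ‖x‖ + ‖q‖ * ‖y‖) ^ 2 := by gcongr
    _ ≤ _ := by nlinarith [sq_nonneg (‖p‖ * ‖y‖ - ‖q‖ * ‖x‖)]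

lemma block_norm_sq_le (p q r u x y : ℂ) :
    ‖p * x + q * y‖ ^ 2 + ‖r * x + u * y‖ ^ 2 ≤
      (‖p‖ ^ 2 + ‖q‖ ^ 2 + ‖r‖ ^ 2 + ‖u‖ ^ 2) * (‖x‖ ^ 2 + ‖y‖ ^ 2) := by
  linarith [norm_sq_add_le p q x y, norm_sq_add_le r u x y]

/-- The adjugate has the same Frobenius norm as the block, and composing it with the block
multiplies by the determinant. -/
lemma det_mul_norm_sq_le (p q r u x y : ℂ) :
    ‖p * u - q * r‖ ^ 2 * (‖x‖ ^ 2 + ‖y‖ ^ 2) ≤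
      (‖p‖ ^ 2 + ‖q‖ ^ 2 + ‖r‖ ^ 2 + ‖u‖ ^ 2) *
        (‖p * x + q * y‖ ^ 2 + ‖r * x + u * y‖ ^ 2) := by
  have h := block_norm_sq_le u (-q) (-r) p (p * x + q * y) (r * x + u * y)
  rw [show u * (p * x + q * y) + -q * (r * x + u * y) = (p * u - q * r) * x by ring,
    show -r * (p * x + q * y) + p * (r * x + u * y) = (p * u - q * r) * y by ring, norm_mul,
    norm_mul, norm_neg, norm_neg] at h
  linarith

/-! ### The matrix `X` -/

/-- The common modulus of the entries of `X^β`. -/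
def dAmp (b : Background) (β : WaveMode) : ℝ := ‖dCoeff b β 0 0‖

lemma dAmp_pos (b : Background) (β : WaveMode) : 0 < dAmp b β := by
  have h1 := b.ρ_pos
  have h2 := b.ω_pos
  have h3 := b.speed_pos β
  have h4 := b.waveNumber_pos β
  have h5 : ((4 * b.ρ * b.ω ^ 2 : ℝ) : ℂ) ≠ 0 := by
    exact_mod_cast (by positivity : 4 * b.ρ * b.ω ^ 2 ≠ 0)
  have h6 : ((b.ρ * b.speed β ^ 2 * b.waveNumber β : ℝ) : ℂ) ≠ 0 := by
    exact_mod_cast (by positivity : b.ρ * b.speed β ^ 2 * b.waveNumber β ≠ 0)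
  rw [dAmp, norm_pos_iff, dCoeff, aCoeff]
  exact mul_ne_zero (div_ne_zero Complex.I_ne_zero h5)
    (mul_ne_zero (neg_ne_zero.2 (div_ne_zero Complex.I_ne_zero h6)) (Complex.exp_ne_zero _))

lemma dCoeff_eq (b : Background) (β : WaveMode) (m : ℤ) (θ : ℝ) :
    dCoeff b β m θ = Complex.exp (-(m * (θ * Complex.I))) *
      (dCoeff b β 0 0 * Complex.exp ((m * (Real.pi / 2) : ℝ) * Complex.I)) := by
  have h : Complex.exp (Complex.I * m * ((Real.pi / 2 - θ : ℝ) : ℂ)) =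
      Complex.exp (-(m * (θ * Complex.I))) *
        Complex.exp ((m * (Real.pi / 2) : ℝ) * Complex.I) := by
    rw [← Complex.exp_add]
    congr 1
    push_cast
    ring
  rw [dCoeff, dCoeff, aCoeff, aCoeff, h]
  simp
  ring

lemma sum_norm_sq_XMode_mulVec (b : Background) (β : WaveMode) {K Ns : ℕ} (hN : 2 * K + 1 ≤ Ns)
    (v : Modes K → ℂ) :
    ∑ s, ‖(XMode b β K Ns *ᵥ v) s‖ ^ 2 = Ns * (dAmp b β ^ 2 * ∑ m, ‖v m‖ ^ 2) := by
  have h : ∀ s, (XMode b β K Ns *ᵥ v) s =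
      ∑ m : Modes K, Complex.exp (-((m : ℤ) * (angle s * Complex.I))) *
        (dCoeff b β 0 0 * Complex.exp (((m : ℤ) * (Real.pi / 2) : ℝ) * Complex.I) * v m) := by
    intro s
    rw [Matrix.mulVec, dotProduct]
    refine Finset.sum_congr rfl fun m _ => ?_
    simp only [XMode, Matrix.of_apply]
    rw [dCoeff_eq]
    ring
  simp_rw [h]
  rw [sum_norm_sq_exp_angle hN, Finset.mul_sum (a := dAmp b β ^ 2)]
  congr 1
  refine Finset.sum_congr rfl fun m _ => ?_
  rw [norm_mul, norm_mul, Complex.norm_exp_ofReal_mul_I, mul_one, mul_pow, dAmp]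

lemma sum_norm_sq_X_mulVec (b : Background) {K Ns : ℕ} (hN : 2 * K + 1 ≤ Ns)
    (v : Modes K ⊕ Modes K → ℂ) :
    ∑ s, ‖(X b K Ns *ᵥ v) s‖ ^ 2 =
      Ns * (dAmp b .P ^ 2 * ∑ m, ‖v (.inl m)‖ ^ 2 + dAmp b .S ^ 2 * ∑ m, ‖v (.inr m)‖ ^ 2) := by
  rw [Fintype.sum_sum_type, X, Matrix.fromBlocks_mulVec]
  simp only [Sum.elim_inl, Sum.elim_inr, Matrix.zero_mulVec, add_zero, zero_add]
  rw [sum_norm_sq_XMode_mulVec b .P hN, sum_norm_sq_XMode_mulVec b .S hN, mul_add]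
  rfl

lemma X_lower (b : Background) {K Ns : ℕ} (hN : 2 * K + 1 ≤ Ns) (v : Modes K ⊕ Modes K → ℂ) :
    Ns * min (dAmp b .P) (dAmp b .S) ^ 2 * ∑ m, ‖v m‖ ^ 2 ≤ ∑ s, ‖(X b K Ns *ᵥ v) s‖ ^ 2 := by
  have hP := dAmp_pos b .P
  have hS := dAmp_pos b .S
  have h0 : 0 ≤ min (dAmp b .P) (dAmp b .S) := le_min hP.le hS.le
  rw [sum_norm_sq_X_mulVec b hN, Fintype.sum_sum_type, mul_assoc, mul_add (min _ _ ^ 2)]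
  gcongr
  · exact min_le_left _ _
  · exact min_le_right _ _

lemma X_upper (b : Background) {K Ns : ℕ} (hN : 2 * K + 1 ≤ Ns) (v : Modes K ⊕ Modes K → ℂ) :
    ∑ s, ‖(X b K Ns *ᵥ v) s‖ ^ 2 ≤ Ns * max (dAmp b .P) (dAmp b .S) ^ 2 * ∑ m, ‖v m‖ ^ 2 := by
  have hP := dAmp_pos b .P
  have hS := dAmp_pos b .S
  rw [sum_norm_sq_X_mulVec b hN, Fintype.sum_sum_type, mul_assoc, mul_add (max _ _ ^ 2)]
  gcongr
  · exact le_max_left _ _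
  · exact le_max_right _ _

/-! ### The matrix `Y` -/

/-- The radial component of the wave `H^P_m` at radius `R`, up to the phase and conjugation. -/
def parP (b : Background) (R : ℝ) (m : ℤ) : ℂ :=
  (starRingEnd ℂ) (hankelRad m.natAbs (b.waveNumber .P * R) / R)

/-- The radial component of the wave `H^S_m` at radius `R`, up to the phase and conjugation. -/
def parS (b : Background) (R : ℝ) (m : ℤ) : ℂ :=
  (starRingEnd ℂ) (Complex.I * m * hankelNat m.natAbs (b.waveNumber .S * R) / R)

/-- The angular component of the wave `H^P_m` at radius `R`, up to the phase and conjugation. -/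
def perpP (b : Background) (R : ℝ) (m : ℤ) : ℂ :=
  (starRingEnd ℂ) (Complex.I * m * hankelNat m.natAbs (b.waveNumber .P * R) / R)

/-- The angular component of the wave `H^S_m` at radius `R`, up to the phase and conjugation. -/
def perpS (b : Background) (R : ℝ) (m : ℤ) : ℂ :=
  (starRingEnd ℂ) (-(hankelRad m.natAbs (b.waveNumber .S * R) / R))

lemma conj_phase (m : ℤ) (θ : ℝ) : (starRingEnd ℂ) (phase m θ) =
    Complex.exp (-(m * (θ * Complex.I))) * (starRingEnd ℂ) (hankelSign m) := by
  rw [phase, map_mul, ← Complex.exp_conj, mul_comm]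
  simp

lemma sum_norm_sq_Y_mulVec (b : Background) {R : ℝ} (hR : 0 < R) {K Nr : ℕ}
    (hN : 2 * K + 1 ≤ Nr) (w : Modes K ⊕ Modes K → ℂ) :
    ∑ r, ‖(Y b R K Nr *ᵥ w) r‖ ^ 2 = Nr * ∑ m : Modes K,
      (‖parP b R m * w (.inl m) + parS b R m * w (.inr m)‖ ^ 2 +
        ‖perpP b R m * w (.inl m) + perpS b R m * w (.inr m)‖ ^ 2) := by
  have hpar : ∀ r, (YPar b .P R K Nr *ᵥ (w ∘ Sum.inl)) r + (YPar b .S R K Nr *ᵥ (w ∘ Sum.inr)) r =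
      ∑ m : Modes K, Complex.exp (-((m : ℤ) * (angle r * Complex.I))) *
        ((starRingEnd ℂ) (hankelSign m) *
          (parP b R m * w (.inl m) + parS b R m * w (.inr m))) := by
    intro r
    rw [Matrix.mulVec, Matrix.mulVec, dotProduct, dotProduct, ← Finset.sum_add_distrib]
    refine Finset.sum_congr rfl fun m _ => ?_
    simp only [YPar, Matrix.of_apply, Function.comp_apply]
    rw [dotReal_star, dotReal_star, dotReal_extWave_P_dir b m hR, dotReal_extWave_S_dir b m hR,
      map_mul, map_mul, conj_phase, parP, parS]
    ring
  have hperp : ∀ r,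
      (YPerp b .P R K Nr *ᵥ (w ∘ Sum.inl)) r + (YPerp b .S R K Nr *ᵥ (w ∘ Sum.inr)) r =
      ∑ m : Modes K, Complex.exp (-((m : ℤ) * (angle r * Complex.I))) *
        ((starRingEnd ℂ) (hankelSign m) *
          (perpP b R m * w (.inl m) + perpS b R m * w (.inr m))) := by
    intro r
    rw [Matrix.mulVec, Matrix.mulVec, dotProduct, dotProduct, ← Finset.sum_add_distrib]
    refine Finset.sum_congr rfl fun m _ => ?_
    simp only [YPerp, Matrix.of_apply, Function.comp_apply]
    rw [dotReal_star, dotReal_star, dotReal_extWave_P_dirPerp b m hR,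
      dotReal_extWave_S_dirPerp b m hR, map_mul, map_mul, conj_phase, perpP, perpS]
    ring
  rw [Fintype.sum_sum_type, Y, Matrix.fromBlocks_mulVec]
  simp only [Sum.elim_inl, Sum.elim_inr, Pi.add_apply]
  simp_rw [hpar, hperp]
  rw [sum_norm_sq_exp_angle hN, sum_norm_sq_exp_angle hN, ← mul_add, ← Finset.sum_add_distrib]
  congr 1
  refine Finset.sum_congr rfl fun m _ => ?_
  rw [norm_mul, norm_mul, RCLike.norm_conj, norm_hankelSign, one_mul, one_mul]

lemma norm_intCast_eq_natAbs (m : ℤ) : ‖(m : ℂ)‖ = ‖(m.natAbs : ℂ)‖ := by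
  rw [Complex.norm_intCast, Complex.norm_natCast, Nat.cast_natAbs, Int.cast_abs]

lemma block_sq_eq (b : Background) {R : ℝ} (hR : 0 < R) (m : ℤ) :
    ‖parP b R m‖ ^ 2 + ‖parS b R m‖ ^ 2 + ‖perpP b R m‖ ^ 2 + ‖perpS b R m‖ ^ 2 =
      hankelSq m.natAbs (b.waveNumber .P * R) (b.waveNumber .S * R) / R ^ 2 := by
  simp only [parP, parS, perpP, perpS, hankelSq, RCLike.norm_conj, norm_neg, norm_div, norm_mul,
    Complex.norm_I, one_mul, norm_intCast_eq_natAbs, Complex.norm_real,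
    Real.norm_of_nonneg hR.le]
  ring

lemma block_det_eq (b : Background) {R : ℝ} (hR : 0 < R) (m : ℤ) :
    ‖parP b R m * perpS b R m - parS b R m * perpP b R m‖ =
      ‖hankelDet m.natAbs (b.waveNumber .P * R) (b.waveNumber .S * R)‖ / R ^ 2 := by
  have hR' : (R : ℂ) ≠ 0 := by exact_mod_cast hR.ne'
  have hm : ((m.natAbs : ℂ)) ^ 2 = (m : ℂ) ^ 2 := by
    rw [Nat.cast_natAbs]
    exact_mod_cast sq_abs m
  have h : parP b R m * perpS b R m - parS b R m * perpP b R m =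
      (starRingEnd ℂ) (-(hankelDet m.natAbs (b.waveNumber .P * R) (b.waveNumber .S * R) /
        (R : ℂ) ^ 2)) := by
    rw [parP, perpS, parS, perpP, ← map_mul, ← map_mul, ← map_sub, hankelDet, hm]
    congr 1
    field_simp
    rw [Complex.I_sq]
    ring
  rw [h, RCLike.norm_conj, norm_neg, norm_div, norm_pow, Complex.norm_real,
    Real.norm_of_nonneg hR.le]

lemma Y_upper (b : Background) {R : ℝ} (hR : 0 < R) {K Nr : ℕ} (hN : 2 * K + 1 ≤ Nr) {U : ℝ}
    (hU : ∀ n ≤ K, hankelSq n (b.waveNumber .P * R) (b.waveNumber .S * R) ≤ U)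
    (w : Modes K ⊕ Modes K → ℂ) :
    ∑ r, ‖(Y b R K Nr *ᵥ w) r‖ ^ 2 ≤ Nr * (U / R ^ 2) * ∑ m, ‖w m‖ ^ 2 := by
  rw [sum_norm_sq_Y_mulVec b hR hN, Fintype.sum_sum_type, ← Finset.sum_add_distrib, mul_assoc,
    Finset.mul_sum (a := U / R ^ 2)]
  gcongr with m
  refine (block_norm_sq_le _ _ _ _ _ _).trans ?_
  rw [block_sq_eq b hR]
  gcongr
  refine hU _ ?_
  have := Finset.mem_Icc.1 m.2
  omega

/-- Each block satisfies `σ_min ≥ |det|/‖·‖_F`. The squared determinant carries `R^(-4)` and the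
squared norm `R^(-2)`, which leaves `1/(B R²)`. -/
lemma Y_lower (b : Background) {R : ℝ} (hR : 0 < R) {K Nr : ℕ} (hN : 2 * K + 1 ≤ Nr) {B : ℝ}
    (hB : 0 < B) (h : ∀ n, hankelSq n (b.waveNumber .P * R) (b.waveNumber .S * R) ≤
      B * ‖hankelDet n (b.waveNumber .P * R) (b.waveNumber .S * R)‖ ^ 2)
    (w : Modes K ⊕ Modes K → ℂ) :
    Nr * (1 / (B * R ^ 2)) * ∑ m, ‖w m‖ ^ 2 ≤ ∑ r, ‖(Y b R K Nr *ᵥ w) r‖ ^ 2 := by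
  rw [sum_norm_sq_Y_mulVec b hR hN, Fintype.sum_sum_type, ← Finset.sum_add_distrib, mul_assoc,
    Finset.mul_sum (a := 1 / (B * R ^ 2))]
  gcongr with m
  have h1 := det_mul_norm_sq_le (parP b R m) (parS b R m) (perpP b R m) (perpS b R m)
    (w (.inl m)) (w (.inr m))
  rw [block_sq_eq b hR, block_det_eq b hR] at h1
  set D := ‖hankelDet (m : ℤ).natAbs (b.waveNumber .P * R) (b.waveNumber .S * R)‖
  have hD : 0 < D ^ 2 := by
    have : 0 < D := norm_pos_iff.2 (hankelDet_ne_zero _ (mul_pos (b.waveNumber_pos .P) hR)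
      (mul_pos (b.waveNumber_pos .S) hR))
    positivity
  set Q := ‖parP b R m * w (.inl m) + parS b R m * w (.inr m)‖ ^ 2 +
    ‖perpP b R m * w (.inl m) + perpS b R m * w (.inr m)‖ ^ 2 with hQ
  have hQ0 : 0 ≤ Q := by positivity
  have h2 : D ^ 2 * ((‖w (.inl m)‖ ^ 2 + ‖w (.inr m)‖ ^ 2) / R ^ 4) ≤ D ^ 2 * (B * Q / R ^ 2) := by
    calc _ = (D / R ^ 2) ^ 2 * (‖w (.inl m)‖ ^ 2 + ‖w (.inr m)‖ ^ 2) := by ring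
      _ ≤ _ := h1
      _ ≤ B * D ^ 2 / R ^ 2 * Q := by gcongr; exact h _
      _ = _ := by ring
  have h3 := le_of_mul_le_mul_left h2 hD
  rw [div_le_div_iff₀ (by positivity) (by positivity)] at h3
  have h4 : (‖w (.inl m)‖ ^ 2 + ‖w (.inr m)‖ ^ 2) ≤ Q * (B * R ^ 2) := by
    refine le_of_mul_le_mul_right (a := R ^ 2) ?_ (by positivity)
    linarith
  rw [one_div_mul_eq_div, div_le_iff₀ (by positivity)]
  exact h4

/-! ### The condition number -/

theorem exists_cond_L_le (b : Background) :
    ∃ C : ℝ, 0 < C ∧ ∀ R : ℝ, 0 < R → ∃ K₀ : ℕ, ∀ K : ℕ, K₀ ≤ K →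
      ∀ Ns Nr : ℕ, 2 * K + 1 ≤ Ns → 2 * K + 1 ≤ Nr →
        0 < sigmaMin (L b R K Ns Nr) ∧
          cond (L b R K Ns Nr) ≤ C * (b.CR .P R * (K : ℝ)) ^ (K + 1) := by
  have hP := dAmp_pos b .P
  have hS := dAmp_pos b .S
  set u := max (dAmp b .P) (dAmp b .S)
  set l := min (dAmp b .P) (dAmp b .S)
  have hu : 0 < u := lt_max_of_lt_left hP
  have hl : 0 < l := lt_min hP hS
  -- The bound on the conditioning of `X`, fixed before `R` is introduced.
  refine ⟨u / l, by positivity, fun R hR => ?_⟩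
  have hs : 0 < b.waveNumber .P * R := mul_pos (b.waveNumber_pos .P) hR
  have hst : b.waveNumber .P * R ≤ b.waveNumber .S * R := by
    have := b.waveNumber_P_le_S
    gcongr
  obtain ⟨B, hB, hBD⟩ := exists_hankelSq_le hs hst
  obtain ⟨K₀, hK₀⟩ := Filter.eventually_atTop.1
    -- With this `ε` the `R`-dependent `B` cancels in the quotient of the two bounds for `Y`.
    (eventually_forall_hankelSq_le hs hst (ε := 1 / √B) (by positivity))
  refine ⟨K₀, fun K hK Ns Nr hNs hNr => ?_⟩
  have hU := hK₀ K hK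
  have hCR : 2 / (Real.exp 1 * (b.waveNumber .P * R)) = b.CR .P R := by
    rw [Background.CR, mul_assoc]
  rw [hCR] at hU
  set p := (b.CR .P R * (K : ℝ)) ^ (K + 1)
  have hp : 0 ≤ p := by
    have : 0 ≤ b.CR .P R := by rw [← hCR]; positivity
    positivity
  have hNs' : (0 : ℝ) < Ns := by exact_mod_cast (by omega : 0 < Ns)
  have hNr' : (0 : ℝ) < Nr := by exact_mod_cast (by omega : 0 < Nr)
  have hne : Nonempty (Modes K) := ⟨⟨0, by simp⟩⟩
  have hmax := sq_sigmaMax_le (T := L b R K Ns Nr)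
    (u := Ns * u ^ 2 * (Nr * ((1 / √B * p) ^ 2 / R ^ 2))) fun M => by
      -- Right multiplication by `Y*` becomes left multiplication by `Y` after taking adjoints,
      -- which preserves the Frobenius norm.
      rw [mul_assoc, ← frobSq_conjTranspose M]
      refine le_trans (b := Ns * u ^ 2 * frobSq (M * (Y b R K Nr)ᴴ)) ?_ ?_
      · have := frobSq_mul_le (X_upper b hNs) (M * (Y b R K Nr)ᴴ)
        rwa [← Matrix.mul_assoc] at this
      · gcongr
        have := frobSq_mul_le (Y_upper b hR hNr hU) Mᴴ
        rwa [← frobSq_conjTranspose (Y b R K Nr * Mᴴ), Matrix.conjTranspose_mul,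
          Matrix.conjTranspose_conjTranspose] at this
  have hmin := le_sq_sigmaMin (T := L b R K Ns Nr)
    (l := Ns * l ^ 2 * (Nr * (1 / (B * R ^ 2)))) fun M => by
      rw [mul_assoc, ← frobSq_conjTranspose M]
      refine le_trans (b := Ns * l ^ 2 * frobSq (M * (Y b R K Nr)ᴴ)) ?_ ?_
      · gcongr
        have := mul_frobSq_le (Y_lower b hR hNr hB hBD) Mᴴ
        rwa [← frobSq_conjTranspose (Y b R K Nr * Mᴴ), Matrix.conjTranspose_mul,
          Matrix.conjTranspose_conjTranspose] at this
      · have := mul_frobSq_le (X_lower b hNs) (M * (Y b R K Nr)ᴴ)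
        rwa [← Matrix.mul_assoc] at this
  have hlpos : 0 < Ns * l ^ 2 * (Nr * (1 / (B * R ^ 2))) := by positivity
  have hσ : 0 < sigmaMin (L b R K Ns Nr) := by
    refine lt_of_le_of_ne (LinearMap.singularValues_nonneg _ _) fun h => ?_
    rw [← h] at hmin
    linarith [hmin.trans_eq (zero_pow two_ne_zero)]
  refine ⟨hσ, ?_⟩
  rw [cond, div_le_iff₀ hσ]
  refine le_of_sq_le_sq ?_ (by positivity)
  refine hmax.trans ?_
  rw [mul_pow _ (sigmaMin _)]
  refine le_trans (le_of_eq ?_) (mul_le_mul_of_nonneg_left hmin (by positivity))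
  have hBsq : √B ^ 2 = B := Real.sq_sqrt hB.le
  rw [mul_pow (1 / √B), div_pow, hBsq]
  field_simp

end
end ElasticMSR

theorem corollary4p5 (b : ElasticMSR.Background) :
    ∃ C : ℝ, 0 < C ∧ ∀ R : ℝ, 0 < R → ∃ K₀ : ℕ, ∀ K : ℕ, K₀ ≤ K →
      ∀ Ns Nr : ℕ, 2 * K + 1 ≤ Ns → 2 * K + 1 ≤ Nr →
        0 < ElasticMSR.sigmaMin (ElasticMSR.L b R K Ns Nr) ∧
          ElasticMSR.cond (ElasticMSR.L b R K Ns Nr) ≤ C * (b.CR .P R * (K : ℝ)) ^ (K + 1) :=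
  ElasticMSR.exists_cond_L_le b
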